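/- **Definitions.** A *sketch* is a finite graph together with a set of commutativity conditions and a set of convergence conditions. A *commutativity condition* is a pair of finite paths (possibly of length $0$) with the same source and the same target. A *convergence condition* is a finite limit condition or a finite colimit condition. A *finite limit condition* is a tuple $(\mathcal H, D, C, (c_H)_{H\in\mathcal H})$, where $\mathcal H$ is a finite graph, $D$ is a morphism of graphs from $\mathcal H$ to the given graph, $C$ is a vertex and $c_H\colon C\to D(H)$ are arrows; a *finite colimit condition* is the same with arrows $c_H\colon D(H)\to C$. Such tuples are taken up to isomorphism of $\mathcal H$ compatible with $D$ and $(c_H)$. A *morphism of sketches* is a morphism of graphs that carries each commutativity, finite limit and finite colimit condition to a condition of the same kind. A *subsketch inclusion* is a morphism of sketches whose underlying morphism of graphs is the inclusion of a subgraph. For a sketch $\mathcal X$ and a category $\mathbb C$, an *$\mathcal X$-structure* in $\mathbb C$ is a morphism of graphs $F\colon \mathcal X\to\mathbb C$ that carries each commutativity condition to a commutative diagram and each finite limit (colimit) condition to a limit cone (colimit cocone). With natural transformations as morphisms, $\mathcal X$-structures form a category $\mathcal X\mathbb C$. A morphism of sketches $\varphi\colon\mathcal A\to\mathcal B$ induces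 a functor $\varphi_{\mathbb C}\colon \mathcal B\mathbb C\to\mathcal A\mathbb C$, $G\mapsto G\circ\varphi$. An *exactness sequent* $\alpha\vdash\beta$ is a sequence $\mathcal X\xrightarrow{\alpha}\mathcal A\xrightarrow{\beta}\mathcal B$ of subsketch inclusions. For an $\mathcal X$-structure $F$ in $\mathbb C$, let $\mathcal A^{\alpha}_F\mathbb C$ and $\mathcal B^{\beta\alpha}_F\mathbb C$ be the fibres at $F$ of $\alpha_{\mathbb C}$ and $(\beta\alpha)_{\mathbb C}$: the objects are the structures $G$ whose restriction to $\mathcal X$ equals $F$, and the morphisms are those whose restriction to $\mathcal X$ is the identity of $F$. A *functorial verification* of $\alpha\vdash\beta$ for $F$ is a functor $E\colon\mathcal A^{\alpha}_F\mathbb C\to\mathcal B^{\beta\alpha}_F\mathbb C$ that is a (strict) right inverse of the restriction $\beta^{\alpha}_F\colon\mathcal B^{\beta\alpha}_F\mathbb C\to\mathcal A^{\alpha}_F\mathbb C$ of $\beta_{\mathbb C}$, that is, $\beta^{\alpha}_F\circ E=\mathrm{id}$. The *underlying sketch* of a finite category has the underlying graph of the category, the commutativity conditions $(f,g)=(g\circ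 f)$ for each composable pair $f,g$ (a path of length $2$ and a path of length $1$) and $(1_A)=()$ for each object $A$ (a path of length $1$ and the empty path at $A$), and no convergence conditions. The inclusion $\alpha\colon\mathcal X\to\mathcal A$ is *unconditional of finite kind* if $\mathcal A$ is the underlying sketch of a finite category, further equipped with the commutativity and convergence conditions that already appear in $\mathcal X$, and no others. For a small finitely complete category $\mathbb C$, let $\mathrm{Lex}(\mathbb C,\mathbf{Set})$ be the category of finite limit preserving functors $\mathbb C\to\mathbf{Set}$ and let $\mathsf y\colon\mathbb C\to\mathrm{Lex}(\mathbb C,\mathbf{Set})^{\mathrm{op}}$, $C\mapsto\hom_{\mathbb C}(C,-)$, be the restricted Yoneda embedding. It preserves finite limits and all colimits, so $\mathsf yF=\mathsf y\circ F$ is an $\mathcal X$-structure for every $\mathcal X$-structure $F$ in $\mathbb C$. **Theorem.** Let $\mathcal X\xrightarrow{\alpha}\mathcal A\xrightarrow{\beta}\mathcal B$ be an exactness sequent such that $\alpha$ is unconditional of finite kind, let $\mathbb C$ be a small finitely complete category, and let $F$ be an $\mathcal X$-structure in $\mathbb C$. If there is a functorial verification of $\alpha\vdash\beta$ for $F$ in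 $\mathbb C$, then there is also a functorial verification of $\alpha\vdash\beta$ for $\mathsf yF$ in $\mathrm{Lex}(\mathbb C,\mathbf{Set})^{\mathrm{op}}$. -/

import Mathlib

open CategoryTheory CategoryTheory.Limits Opposite

universe v u v' u'

attribute [local instance 2000] CategoryStruct.toQuiver

namespace Exactness

/-! ### Conditions in a graph

Graphs are Mathlib quivers.  Finite graphs are taken with vertices and arrows in `Type`; up to
isomorphism this covers every finite graph. -/

/-- A commutativity condition in a graph: two paths with the same source and the same target. -/
structure CommCond (V : Type) [Quiver.{0} V] where
  src : V
  tgt : V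
  lhs : Quiver.Path src tgt
  rhs : Quiver.Path src tgt

/-- The image of a commutativity condition under a morphism of graphs. -/
def CommCond.map {V W : Type} [Quiver.{0} V] [Quiver.{0} W] (φ : V ⥤q W) (c : CommCond V) :
    CommCond W where
  src := φ.obj c.src
  tgt := φ.obj c.tgt
  lhs := φ.mapPath c.lhs
  rhs := φ.mapPath c.rhs

theorem CommCond.map_comp {U V W : Type} [Quiver.{0} U] [Quiver.{0} V] [Quiver.{0} W]
    (φ : U ⥤q V) (ψ : V ⥤q W) (c : CommCond U) : c.map (φ ⋙q ψ) = (c.map φ).map ψ := by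
  obtain ⟨a, b, p, q⟩ := c
  have h : ∀ p : Quiver.Path a b, (φ ⋙q ψ).mapPath p = ψ.mapPath (φ.mapPath p) :=
    fun p => Prefunctor.mapPath_comp_apply φ ψ p
  simp only [CommCond.map, h]
  rfl

/-- A finite diagram `D : H ⥤q V` in a graph, a vertex `C` and arrows `c_h : C ⟶ D h`. -/
structure ConeData (V : Type) [Quiver.{0} V] : Type 1 where
  shape : Type
  [quiver : Quiver.{0} shape]
  [finite_obj : Finite shape]
  [finite_arr : ∀ a b : shape, Finite (a ⟶ b)]
  diagram : shape ⥤q V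
  pt : V
  leg : ∀ h : shape, pt ⟶ diagram.obj h

/-- A finite diagram `D : H ⥤q V` in a graph, a vertex `C` and arrows `c_h : D h ⟶ C`. -/
structure CoconeData (V : Type) [Quiver.{0} V] : Type 1 where
  shape : Type
  [quiver : Quiver.{0} shape]
  [finite_obj : Finite shape]
  [finite_arr : ∀ a b : shape, Finite (a ⟶ b)]
  diagram : shape ⥤q V
  pt : V
  leg : ∀ h : shape, diagram.obj h ⟶ pt

attribute [instance] ConeData.quiver ConeData.finite_obj ConeData.finite_arr
attribute [instance] CoconeData.quiver CoconeData.finite_obj CoconeData.finite_arr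

/-- Isomorphisms of graphs: morphisms that are bijective on vertices and on arrows. -/
structure IsGraphIso {H H' : Type} [Quiver.{0} H] [Quiver.{0} H'] (I : H ⥤q H') : Prop where
  obj_bijective : Function.Bijective I.obj
  map_bijective : ∀ a b : H, Function.Bijective (fun e : a ⟶ b => I.map e)

/-- `(H, D, C, c)` and `(H', D', C', c')` are equivalent if `C = C'` and there is an isomorphism of
graphs `I : H ⥤q H'` with `D = I ⋙q D'` and `c h = c' (I h)`. -/
inductive ConeData.Equivalent {V : Type} [Quiver.{0} V] : ConeData V → ConeData V → Prop
  | mk {H H' : Type} [Quiver.{0} H] [Quiver.{0} H'] [Finite H] [Finite H']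
      [∀ a b : H, Finite (a ⟶ b)] [∀ a b : H', Finite (a ⟶ b)]
      (I : H ⥤q H') (hI : IsGraphIso I) (D' : H' ⥤q V) (C : V) (c' : ∀ h, C ⟶ D'.obj h) :
      ConeData.Equivalent
        { shape := H, diagram := I ⋙q D', pt := C, leg := fun h => c' (I.obj h) }
        { shape := H', diagram := D', pt := C, leg := c' }

/-- The same equivalence for tuples with arrows `c_h : D h ⟶ C`. -/
inductive CoconeData.Equivalent {V : Type} [Quiver.{0} V] : CoconeData V → CoconeData V → Prop
  | mk {H H' : Type} [Quiver.{0} H] [Quiver.{0} H'] [Finite H] [Finite H']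
      [∀ a b : H, Finite (a ⟶ b)] [∀ a b : H', Finite (a ⟶ b)]
      (I : H ⥤q H') (hI : IsGraphIso I) (D' : H' ⥤q V) (C : V) (c' : ∀ h, D'.obj h ⟶ C) :
      CoconeData.Equivalent
        { shape := H, diagram := I ⋙q D', pt := C, leg := fun h => c' (I.obj h) }
        { shape := H', diagram := D', pt := C, leg := c' }

/-- Finite limit conditions in a graph: equivalence classes of tuples `(H, D, C, c)`. -/
def LimCond (V : Type) [Quiver.{0} V] : Type 1 :=
  Quot (ConeData.Equivalent (V := V))

/-- Finite colimit conditions in a graph: equivalence classes of tuples `(H, D, C, c)`. -/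
def ColimCond (V : Type) [Quiver.{0} V] : Type 1 :=
  Quot (CoconeData.Equivalent (V := V))

/-- The image of a tuple under a morphism of graphs. -/
def ConeData.map {V W : Type} [Quiver.{0} V] [Quiver.{0} W] (φ : V ⥤q W) (K : ConeData V) :
    ConeData W where
  shape := K.shape
  diagram := K.diagram ⋙q φ
  pt := φ.obj K.pt
  leg h := φ.map (K.leg h)

/-- The image of a tuple under a morphism of graphs. -/
def CoconeData.map {V W : Type} [Quiver.{0} V] [Quiver.{0} W] (φ : V ⥤q W) (K : CoconeData V) :
    CoconeData W where
  shape := K.shape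
  diagram := K.diagram ⋙q φ
  pt := φ.obj K.pt
  leg h := φ.map (K.leg h)

/-- The image of a finite limit condition under a morphism of graphs. -/
def LimCond.map {V W : Type} [Quiver.{0} V] [Quiver.{0} W] (φ : V ⥤q W) :
    LimCond V → LimCond W :=
  Quot.map (ConeData.map φ) (by
    rintro _ _ ⟨I, hI, D', C, c'⟩
    exact ConeData.Equivalent.mk I hI (D' ⋙q φ) (φ.obj C) (fun h => φ.map (c' h)))

/-- The image of a finite colimit condition under a morphism of graphs. -/
def ColimCond.map {V W : Type} [Quiver.{0} V] [Quiver.{0} W] (φ : V ⥤q W) :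
    ColimCond V → ColimCond W :=
  Quot.map (CoconeData.map φ) (by
    rintro _ _ ⟨I, hI, D', C, c'⟩
    exact CoconeData.Equivalent.mk I hI (D' ⋙q φ) (φ.obj C) (fun h => φ.map (c' h)))

/-! ### Sketches -/

/-- An exactness sketch: a finite graph with a set of commutativity conditions, a set of finite
limit conditions and a set of finite colimit conditions. -/
structure Sketch : Type 1 where
  V : Type
  [quiver : Quiver.{0} V]
  [finite_obj : Finite V]
  [finite_arr : ∀ a b : V, Finite (a ⟶ b)]
  comm : Set (CommCond V)
  lim : Set (LimCond V)
  colim : Set (ColimCond V)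

attribute [instance] Sketch.quiver Sketch.finite_obj Sketch.finite_arr

/-- Morphisms of sketches: morphisms of graphs that carry conditions to conditions. -/
structure Sketch.Hom (X A : Sketch) extends X.V ⥤q A.V where
  comm_mem : ∀ c ∈ X.comm, c.map toPrefunctor ∈ A.comm
  lim_mem : ∀ c ∈ X.lim, c.map toPrefunctor ∈ A.lim
  colim_mem : ∀ c ∈ X.colim, c.map toPrefunctor ∈ A.colim

/-- Composition of morphisms of sketches. -/
def Sketch.Hom.comp {X A B : Sketch} (α : X.Hom A) (β : A.Hom B) : X.Hom B where
  toPrefunctor := α.toPrefunctor ⋙q β.toPrefunctor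
  comm_mem c hc := by
    rw [CommCond.map_comp]
    exact β.comm_mem _ (α.comm_mem c hc)
  lim_mem := by
    rintro ⟨K⟩ hc
    exact β.lim_mem _ (α.lim_mem _ hc)
  colim_mem := by
    rintro ⟨K⟩ hc
    exact β.colim_mem _ (α.colim_mem _ hc)

/-- A subsketch inclusion: a morphism of sketches that embeds the underlying graph of the source as
a subgraph of the target, i.e. is injective on vertices and on arrows. -/
structure Sketch.Hom.IsSubsketchInclusion {X A : Sketch} (α : X.Hom A) : Prop where
  obj_injective : Function.Injective α.obj
  map_injective : ∀ a b : X.V, Function.Injective (fun e : a ⟶ b => α.map e)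

/-- A category whose underlying graph is the given graph. -/
structure CategoryOn (V : Type) [Quiver.{0} V] where
  id : ∀ a : V, a ⟶ a
  comp : ∀ {a b c : V}, (a ⟶ b) → (b ⟶ c) → (a ⟶ c)
  id_comp : ∀ {a b : V} (f : a ⟶ b), comp (id a) f = f
  comp_id : ∀ {a b : V} (f : a ⟶ b), comp f (id b) = f
  assoc : ∀ {a b c d : V} (f : a ⟶ b) (g : b ⟶ c) (h : c ⟶ d),
    comp (comp f g) h = comp f (comp g h)

/-- The Mathlib category given by a `CategoryOn`; its quiver is the given one by definition. -/
abbrev CategoryOn.toCategory {V : Type} [q : Quiver.{0} V] (K : CategoryOn V) :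
    Category.{0} V where
  toQuiver := q
  id := K.id
  comp := K.comp
  id_comp := K.id_comp
  comp_id := K.comp_id
  assoc := K.assoc

/-- The commutativity conditions of the underlying sketch of a category: the path `(f, g)` equals
the path `(gf)` for composable `f`, `g`, and the path `(1_a)` equals the empty path at `a`. -/
inductive CategoryOn.IsUnderlyingCond {V : Type} [Quiver.{0} V] (K : CategoryOn V) :
    CommCond V → Prop
  | comp {a b c : V} (f : a ⟶ b) (g : b ⟶ c) :
      K.IsUnderlyingCond ⟨a, c, f.toPath.comp g.toPath, (K.comp f g).toPath⟩
  | id (a : V) : K.IsUnderlyingCond ⟨a, a, (K.id a).toPath, Quiver.Path.nil⟩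

/-- `α : X ⟶ A` is unconditional of finite kind: `A` is the underlying sketch of a finite category,
further equipped with the conditions which already appear in `X`, and no others. -/
def Sketch.Hom.IsUnconditionalOfFiniteKind {X A : Sketch} (α : X.Hom A) : Prop :=
  ∃ K : CategoryOn A.V,
    A.comm = {c | K.IsUnderlyingCond c} ∪ CommCond.map α.toPrefunctor '' X.comm ∧
    A.lim = LimCond.map α.toPrefunctor '' X.lim ∧
    A.colim = ColimCond.map α.toPrefunctor '' X.colim

/-! ### Limits and colimits of graph-shaped diagrams in a category -/

section GraphLimits

variable {C : Type u} [Category.{v} C] {H : Type} [Quiver.{0} H]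

/-- `(P, c)` is a limit cone over the graph-shaped diagram `D`. -/
structure IsGraphLimit (D : H ⥤q C) (P : C) (c : ∀ h, P ⟶ D.obj h) : Prop where
  w : ∀ {a b : H} (e : a ⟶ b), c a ≫ D.map e = c b
  existsUnique_lift : ∀ (T : C) (t : ∀ h, T ⟶ D.obj h),
    (∀ {a b : H} (e : a ⟶ b), t a ≫ D.map e = t b) → ∃! f : T ⟶ P, ∀ h, f ≫ c h = t h

/-- `(P, c)` is a colimit cocone under the graph-shaped diagram `D`. -/
structure IsGraphColimit (D : H ⥤q C) (P : C) (c : ∀ h, D.obj h ⟶ P) : Prop where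
  w : ∀ {a b : H} (e : a ⟶ b), D.map e ≫ c b = c a
  existsUnique_desc : ∀ (T : C) (t : ∀ h, D.obj h ⟶ T),
    (∀ {a b : H} (e : a ⟶ b), D.map e ≫ t b = t a) → ∃! f : P ⟶ T, ∀ h, c h ≫ f = t h

variable {H' : Type} [Quiver.{0} H']

theorem isGraphLimit_iff_of_iso {I : H ⥤q H'} (hI : IsGraphIso I) (D : H' ⥤q C) (P : C)
    (c : ∀ h, P ⟶ D.obj h) :
    IsGraphLimit (I ⋙q D) P (fun h => c (I.obj h)) ↔ IsGraphLimit D P c := by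
  have key : ∀ (T : C) (t : ∀ h, T ⟶ D.obj h),
      (∀ {a b : H} (e : a ⟶ b), t (I.obj a) ≫ D.map (I.map e) = t (I.obj b)) →
      ∀ {a b : H'} (e : a ⟶ b), t a ≫ D.map e = t b := by
    intro T t ht a b e
    obtain ⟨a, rfl⟩ := hI.obj_bijective.2 a
    obtain ⟨b, rfl⟩ := hI.obj_bijective.2 b
    obtain ⟨e, rfl⟩ := (hI.map_bijective a b).2 e
    exact ht e
  constructor
  · intro h
    refine ⟨key P c h.w, fun T t ht => ?_⟩
    obtain ⟨f, hf, hu⟩ := h.existsUnique_lift T (fun h => t (I.obj h)) (fun e => ht (I.map e))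
    refine ⟨f, fun h => ?_, fun g hg => hu g (fun h => hg _)⟩
    obtain ⟨h, rfl⟩ := hI.obj_bijective.2 h
    exact hf h
  · intro h
    refine ⟨fun e => h.w (I.map e), fun T t ht => ?_⟩
    let E := Equiv.ofBijective I.obj hI.obj_bijective
    obtain ⟨t', rfl⟩ : ∃ t' : ∀ h, T ⟶ D.obj h, (fun h => t' (I.obj h)) = t :=
      ⟨Equiv.piCongrLeft (fun h => T ⟶ D.obj h) E t,
        funext fun h => Equiv.piCongrLeft_apply_apply (fun h => T ⟶ D.obj h) E t h⟩
    obtain ⟨f, hf, hu⟩ := h.existsUnique_lift T t' (key T t' ht)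
    refine ⟨f, fun h => hf _, fun g hg => hu g (fun h => ?_)⟩
    obtain ⟨h, rfl⟩ := hI.obj_bijective.2 h
    exact hg h

theorem isGraphColimit_iff_of_iso {I : H ⥤q H'} (hI : IsGraphIso I) (D : H' ⥤q C) (P : C)
    (c : ∀ h, D.obj h ⟶ P) :
    IsGraphColimit (I ⋙q D) P (fun h => c (I.obj h)) ↔ IsGraphColimit D P c := by
  have key : ∀ (T : C) (t : ∀ h, D.obj h ⟶ T),
      (∀ {a b : H} (e : a ⟶ b), D.map (I.map e) ≫ t (I.obj b) = t (I.obj a)) →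
      ∀ {a b : H'} (e : a ⟶ b), D.map e ≫ t b = t a := by
    intro T t ht a b e
    obtain ⟨a, rfl⟩ := hI.obj_bijective.2 a
    obtain ⟨b, rfl⟩ := hI.obj_bijective.2 b
    obtain ⟨e, rfl⟩ := (hI.map_bijective a b).2 e
    exact ht e
  constructor
  · intro h
    refine ⟨key P c h.w, fun T t ht => ?_⟩
    obtain ⟨f, hf, hu⟩ := h.existsUnique_desc T (fun h => t (I.obj h)) (fun e => ht (I.map e))
    refine ⟨f, fun h => ?_, fun g hg => hu g (fun h => hg _)⟩
    obtain ⟨h, rfl⟩ := hI.obj_bijective.2 h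
    exact hf h
  · intro h
    refine ⟨fun e => h.w (I.map e), fun T t ht => ?_⟩
    let E := Equiv.ofBijective I.obj hI.obj_bijective
    obtain ⟨t', rfl⟩ : ∃ t' : ∀ h, D.obj h ⟶ T, (fun h => t' (I.obj h)) = t :=
      ⟨Equiv.piCongrLeft (fun h => D.obj h ⟶ T) E t,
        funext fun h => Equiv.piCongrLeft_apply_apply (fun h => D.obj h ⟶ T) E t h⟩
    obtain ⟨f, hf, hu⟩ := h.existsUnique_desc T t' (key T t' ht)
    refine ⟨f, fun h => hf _, fun g hg => hu g (fun h => ?_)⟩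
    obtain ⟨h, rfl⟩ := hI.obj_bijective.2 h
    exact hg h

end GraphLimits

/-! ### Structures of a given type in a category -/

section Models

variable (C : Type u) [Category.{v} C]

variable {C}

/-- A morphism of graphs into a category carries a commutativity condition to an actual
commutative diagram. -/
def CommCond.Holds {V : Type} [Quiver.{0} V] (F : V ⥤q C) (c : CommCond V) : Prop :=
  composePath (F.mapPath c.lhs) = composePath (F.mapPath c.rhs)

/-- A morphism of graphs into a category carries a finite limit condition to an actual limit. -/
def LimCond.Holds {V : Type} [Quiver.{0} V] (F : V ⥤q C) : LimCond V → Prop :=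
  Quot.lift
    (fun K => IsGraphLimit (K.diagram ⋙q F) (F.obj K.pt) (fun h => F.map (K.leg h)))
    (by
      rintro _ _ ⟨I, hI, D', P, c'⟩
      exact propext (isGraphLimit_iff_of_iso hI (D' ⋙q F) (F.obj P) (fun h => F.map (c' h))))

/-- A morphism of graphs into a category carries a finite colimit condition to an actual
colimit. -/
def ColimCond.Holds {V : Type} [Quiver.{0} V] (F : V ⥤q C) : ColimCond V → Prop :=
  Quot.lift
    (fun K => IsGraphColimit (K.diagram ⋙q F) (F.obj K.pt) (fun h => F.map (K.leg h)))
    (by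
      rintro _ _ ⟨I, hI, D', P, c'⟩
      exact propext (isGraphColimit_iff_of_iso hI (D' ⋙q F) (F.obj P) (fun h => F.map (c' h))))

variable (C)

/-- An `X`-structure in the category `C`. -/
structure Model (X : Sketch) extends X.V ⥤q C where
  comm_holds : ∀ c ∈ X.comm, c.Holds toPrefunctor
  lim_holds : ∀ c ∈ X.lim, c.Holds toPrefunctor
  colim_holds : ∀ c ∈ X.colim, c.Holds toPrefunctor

variable {C}

/-- Natural transformations between `X`-structures. -/
@[ext]
structure Model.Hom {X : Sketch} (F G : Model C X) where
  app : ∀ x : X.V, F.obj x ⟶ G.obj x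
  naturality : ∀ {x y : X.V} (e : x ⟶ y), F.map e ≫ app y = app x ≫ G.map e

/-- The category of `X`-structures in `C`. -/
instance Model.category (X : Sketch) : Category.{v} (Model C X) where
  Hom F G := Model.Hom F G
  id F := { app := fun x => 𝟙 (F.obj x), naturality := by simp }
  comp m n :=
    { app := fun x => m.app x ≫ n.app x
      naturality := fun e => by
        rw [← Category.assoc, m.naturality, Category.assoc, n.naturality, Category.assoc] }
  id_comp m := Model.Hom.ext (funext fun _ => Category.id_comp _)
  comp_id m := Model.Hom.ext (funext fun _ => Category.comp_id _)
  assoc m n p := Model.Hom.ext (funext fun _ => Category.assoc _ _ _)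

/-- The functor `φ_C` of composition with a morphism of sketches `φ`. -/
def restrict (C : Type u) [Category.{v} C] {X A : Sketch} (φ : X.Hom A) :
    Model C A ⥤ Model C X where
  obj G :=
    { toPrefunctor := φ.toPrefunctor ⋙q G.toPrefunctor
      comm_holds := fun c hc => by
        have h := G.comm_holds _ (φ.comm_mem c hc)
        unfold CommCond.Holds at h ⊢
        rw [Prefunctor.mapPath_comp_apply, Prefunctor.mapPath_comp_apply]
        exact h
      lim_holds := by
        rintro ⟨K⟩ hc
        exact G.lim_holds _ (φ.lim_mem _ hc)
      colim_holds := by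
        rintro ⟨K⟩ hc
        exact G.colim_holds _ (φ.colim_mem _ hc) }
  map m :=
    { app := fun x => m.app (φ.obj x)
      naturality := fun e => m.naturality (φ.map e) }

end Models

/-! ### Functorial verifications -/

section Verification

variable {C : Type u} [Category.{v} C] {X A B : Sketch}

/-- The restriction `β_F^α` of `β_C` to a functor from the fibre of `(βα)_C` at `F` to the fibre of
`α_C` at `F`. -/
def fiberRestrict (α : X.Hom A) (β : A.Hom B) (F : Model C X) :
    (restrict C (α.comp β)).Fiber F ⥤ (restrict C α).Fiber F :=
  Functor.Fiber.inducedFunctor (p := restrict C α) (S := F)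
    (F := Functor.Fiber.fiberInclusion (p := restrict C (α.comp β)) ⋙ restrict C β)
    (Functor.Fiber.fiberInclusion_comp_eq_const (p := restrict C (α.comp β)) (S := F))

/-- There is a functorial verification of the sequent `α ⊢ β` for `F`, i.e. a right inverse functor
of `β_F^α`. -/
def HasFunctorialVerification (α : X.Hom A) (β : A.Hom B) (F : Model C X) : Prop :=
  ∃ E : (restrict C α).Fiber F ⥤ (restrict C (α.comp β)).Fiber F,
    E ⋙ fiberRestrict α β F = 𝟭 _

end Verification

/-! ### The restricted Yoneda embedding -/

section Yoneda

variable (C : Type u) [SmallCategory C]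

/-- `Lex(C, Set)ᵒᵖ`, the dual of the category of finite limit preserving functors `C ⥤ Type`. -/
abbrev ProCompletion : Type (u + 1) := (C ⥤ₗ Type u)ᵒᵖ

/-- The restricted Yoneda embedding `c ↦ hom(c, -)` into `Lex(C, Set)ᵒᵖ`. -/
def y : C ⥤ ProCompletion C where
  obj c := op ⟨coyoneda.obj (op c), by rw [leftExactFunctor_iff]; infer_instance⟩
  map f := Quiver.Hom.op (ObjectProperty.homMk (coyoneda.map f.op))
  map_id c := by
    apply Quiver.Hom.unop_inj
    ext : 1
    simp
  map_comp f g := by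
    apply Quiver.Hom.unop_inj
    ext : 1
    simp

variable {C}

/-- A finite limit preserving functor preserves limits of finite graph-shaped diagrams. -/
theorem IsGraphLimit.map_of_preservesFiniteLimits {C : Type u} [Category.{v} C]
    {D : Type u'} [Category.{v'} D] (P : C ⥤ D) [PreservesFiniteLimits P] {H : Type}
    [Quiver.{0} H] [Finite H] [∀ a b : H, Finite (a ⟶ b)] {K : H ⥤q C} {L : C}
    {c : ∀ h, L ⟶ K.obj h} (hL : IsGraphLimit K L c) :
    IsGraphLimit (K ⋙q P.toPrefunctor) (P.obj L) (fun h => P.map (c h)) := by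
  classical
  let J : MulticospanShape :=
    { L := H
      R := Σ a b : H, (a ⟶ b)
      fst := fun e => e.1
      snd := fun e => e.2.1 }
  let I : MulticospanIndex J C :=
    { left := fun h => K.obj h
      right := fun e => K.obj e.2.1
      fst := fun e => K.map e.2.2
      snd := fun e => 𝟙 _ }
  have : Fintype J.L := Fintype.ofFinite H
  have : Fintype J.R := @Fintype.ofFinite (Σ a b : H, (a ⟶ b)) inferInstance
  let k : Multifork I := Multifork.ofι I L c (fun e => by
    simpa [I] using hL.w e.2.2)
  choose lift hlift hu using hL.existsUnique_lift
  have hk' : ∀ (E : Multifork I) {a b : H} (e : a ⟶ b), E.ι a ≫ K.map e = E.ι b :=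
    fun E a b e => by simpa [I, J] using E.condition (⟨a, b, e⟩ : Σ a b : H, (a ⟶ b))
  let hk : IsLimit k := Multifork.IsLimit.mk _ (fun E => lift E.pt E.ι (hk' E))
    (fun E i => hlift E.pt E.ι (hk' E) i)
    (fun E m hm => hu E.pt E.ι (hk' E) m hm)
  have hP := k.isLimitMapOfPreserves P hk
  refine ⟨fun e => (P.map_comp _ _).symm.trans (congrArg P.map (hL.w e)), fun T t ht => ?_⟩
  refine ⟨Multifork.IsLimit.lift hP t (fun e => ?_), fun h => ?_, fun g hg => ?_⟩
  · exact (ht e.2.2).trans ((Category.comp_id _).symm.trans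
      (congrArg (fun m => t e.2.1 ≫ m) (P.map_id _).symm))
  · exact Multifork.IsLimit.fac hP t _ h
  · refine Multifork.IsLimit.hom_ext hP (fun h => ?_)
    exact (hg h).trans (Multifork.IsLimit.fac hP t _ h).symm

/-- A morphism `P ⟶ y c` in `Lex(C, Set)ᵒᵖ` is an element of `P c`. -/
def homYEquiv (P : ProCompletion C) (c : C) : (P ⟶ (y C).obj c) ≃ P.unop.obj.obj c where
  toFun m := coyonedaEquiv m.unop.hom
  invFun x := Quiver.Hom.op (ObjectProperty.homMk (coyonedaEquiv.symm x))
  left_inv m := by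
    apply Quiver.Hom.unop_inj
    ext : 1
    exact coyonedaEquiv.symm_apply_apply _
  right_inv x := coyonedaEquiv.apply_symm_apply x

theorem homYEquiv_comp {P : ProCompletion C} {c d : C} (m : P ⟶ (y C).obj c) (f : c ⟶ d) :
    homYEquiv P d (m ≫ (y C).map f) = P.unop.obj.map f (homYEquiv P c m) :=
  (coyonedaEquiv_naturality m.unop.hom f).symm

/-- The restricted Yoneda embedding preserves limits of finite graph-shaped diagrams. -/
theorem IsGraphLimit.map_y {H : Type} [Quiver.{0} H] [Finite H] [∀ a b : H, Finite (a ⟶ b)]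
    {K : H ⥤q C} {L : C} {c : ∀ h, L ⟶ K.obj h} (hL : IsGraphLimit K L c) :
    IsGraphLimit (K ⋙q (y C).toPrefunctor) ((y C).obj L) (fun h => (y C).map (c h)) := by
  refine ⟨fun e => ((y C).map_comp _ _).symm.trans (congrArg (y C).map (hL.w e)),
    fun P t ht => ?_⟩
  have : PreservesFiniteLimits P.unop.obj := P.unop.property
  have hP := hL.map_of_preservesFiniteLimits P.unop.obj
  obtain ⟨f, hf, hu⟩ := hP.existsUnique_lift PUnit
    (fun h => TypeCat.ofHom (fun _ => homYEquiv P _ (t h))) (fun {a b} e => by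
      ext
      exact (homYEquiv_comp (t a) (K.map e)).symm.trans (congrArg (homYEquiv P _) (ht e)))
  refine ⟨(homYEquiv P L).symm (f PUnit.unit), fun h => ?_, fun g hg => ?_⟩
  · apply (homYEquiv P _).injective
    refine (homYEquiv_comp _ (c h)).trans ?_
    rw [Equiv.apply_symm_apply]
    exact congrArg (fun m => m PUnit.unit) (hf h)
  · apply (homYEquiv P _).injective
    rw [Equiv.apply_symm_apply, ← hu (TypeCat.ofHom (fun _ => homYEquiv P L g)) (fun h => ?_)]
    · rfl
    · ext
      exact (homYEquiv_comp g (c h)).symm.trans (congrArg (homYEquiv P _) (hg h))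

/-- The restricted Yoneda embedding preserves colimits of graph-shaped diagrams. -/
theorem IsGraphColimit.map_y {H : Type} [Quiver.{0} H]
    {K : H ⥤q C} {L : C} {c : ∀ h, K.obj h ⟶ L} (hL : IsGraphColimit K L c) :
    IsGraphColimit (K ⋙q (y C).toPrefunctor) ((y C).obj L) (fun h => (y C).map (c h)) := by
  refine ⟨fun e => ((y C).map_comp _ _).symm.trans (congrArg (y C).map (hL.w e)),
    fun P t ht => ?_⟩
  -- the component at `Z` of `t h`, as a map from `P Z` to `hom (K h, Z)`
  let s : ∀ (Z : C) (_ : P.unop.obj.obj Z) (h : H), K.obj h ⟶ Z :=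
    fun Z x h => (t h).unop.hom.app Z x
  have hs : ∀ (Z : C) (x : P.unop.obj.obj Z) {a b : H} (e : a ⟶ b),
      K.map e ≫ s Z x b = s Z x a := fun Z x a b e =>
    congrArg (fun m : (y C).obj (K.obj a) ⟶ P => m.unop.hom.app Z x) (ht e)
  choose d hd hu using fun (Z : C) (x : P.unop.obj.obj Z) =>
    hL.existsUnique_desc Z (s Z x) (hs Z x)
  have hn : ∀ {Z W : C} (f : Z ⟶ W) (x : P.unop.obj.obj Z),
      d W (P.unop.obj.map f x) = d Z x ≫ f := by
    intro Z W f x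
    refine (hu W _ _ (fun h => ?_)).symm
    rw [← Category.assoc, hd]
    exact (NatTrans.naturality_apply (t h).unop.hom f x).symm
  refine ⟨Quiver.Hom.op (ObjectProperty.homMk
    { app := fun Z => TypeCat.ofHom (d Z), naturality := fun Z W f => by
        ext x
        exact hn f x }), fun h => ?_, fun g hg => ?_⟩
  · apply Quiver.Hom.unop_inj
    ext Z x
    exact hd Z x h
  · apply Quiver.Hom.unop_inj
    ext Z x
    exact hu Z x _ (fun h => congrArg
      (fun m : (y C).obj (K.obj h) ⟶ P => m.unop.hom.app Z x) (hg h))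

theorem composePath_mapPath_comp {C : Type u} [Category.{v} C] {D : Type u'} [Category.{v'} D]
    {V : Type} [Quiver.{0} V] (F : V ⥤q C) (P : C ⥤ D) {a b : V} (p : Quiver.Path a b) :
    composePath ((F ⋙q P.toPrefunctor).mapPath p) = P.map (composePath (F.mapPath p)) := by
  induction p with
  | nil => exact (P.map_id _).symm
  | cons p e ih =>
    refine Eq.trans ?_ (P.map_comp _ _).symm
    exact congrArg (fun m => m ≫ P.map (F.map e)) ih

/-- The `X`-structure `yF = y ∘ F` in `Lex(C, Set)ᵒᵖ`, for an `X`-structure `F` in `C`. -/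
def Model.yoneda {X : Sketch} (F : Model C X) : Model (ProCompletion C) X where
  toPrefunctor := F.toPrefunctor ⋙q (y C).toPrefunctor
  comm_holds c hc := by
    unfold CommCond.Holds
    rw [composePath_mapPath_comp, composePath_mapPath_comp]
    exact congrArg (y C).map (F.comm_holds c hc)
  lim_holds := by
    rintro ⟨K⟩ hK
    exact IsGraphLimit.map_y (F.lim_holds _ hK)
  colim_holds := by
    rintro ⟨K⟩ hK
    exact IsGraphColimit.map_y (F.colim_holds _ hK)

end Yoneda

end Exactness

/-! Since `α` is unconditional, an `A`-structure is a functor on a finite category whose restriction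
to `X` is an `X`-structure. The core of the argument is that every structure `G` over `yF` is,
vertex by vertex, a cofiltered limit of structures `yH` with `H` in the fibre over `F`
(`isProLimit_fiberApproximation`). Hence evaluation at a vertex of `A` on the fibre over `yF` is the
right Kan extension, along `fiberYoneda`, of evaluation on the fibre over `F` followed by `y`.

A verification `E` for `F` is extended by the same Kan extension, taken at every vertex of `B`. Its
values are cofiltered limits of objects `y c`, and such limits preserve the finite limits and finite
colimits of `C` (`isGraphLimit_proLim`, `isGraphColimit_proLim`), so they form `B`-structures.
Restricted to `A`, the extension becomes the Kan extension of the evaluations, which is the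
inclusion of the fibre up to isomorphism (`nonempty_extendModel_iso`). Restriction along `β` is an
isofibration because `β` is injective on vertices, so the isomorphism can be improved to an
equality.

For the approximation of `G`, forget `F` at first. The functors `T` with a transformation `G ⟶ T ⋙
y` form a cofiltered category because `C` is finitely complete. Evaluation at `a` has a right
adjoint built from finite powers, which `y` preserves; so maps from `G a` to `y c` factor through
some `T`, and equations between such factorizations hold after a refinement. At a vertex of `X` the
object `G a` already has the form `y c`. There `T` can be refined until `G a ⟶ y (T a)` is a split
mono, and then cut down by the resulting idempotent until it is invertible
(`Approx.exists_isIso_of_finite`). An approximation invertible over `X` is isomorphic to one from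
the fibre over `F`, so the latter are cofinal (`exists_toApprox_hom`). -/

namespace Exactness

/-! ### Approximation of pro-objects of functors -/

section Approximation

universe v₁ u₁ v₂ u₂ v₃ u₃

variable {A : Type u₁} [Category.{v₁} A] {C : Type u₂} [Category.{v₂} C]
  {P : Type u₃} [Category.{v₃} P] [HasFiniteLimits C]

/-- The category of functors `T : A ⥤ C` under `G`, that is, with a transformation `G ⟶ T ⋙ Y`. -/
abbrev Approx (Y : C ⥤ P) (G : A ⥤ P) :=
  StructuredArrow G ((Functor.whiskeringRight A C P).obj Y)

variable (Y : C ⥤ P) [PreservesFiniteLimits Y] (G : A ⥤ P)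

/-- Limits of functors are pointwise, so postcomposition with `Y` preserves finite limits and is
therefore flat. -/
instance : IsCofiltered (Approx Y G) := by
  have : PreservesFiniteLimits ((Functor.whiskeringRight A C P).obj Y) :=
    ⟨fun J _ _ => inferInstance⟩
  exact (flat_of_preservesFiniteLimits ((Functor.whiskeringRight A C P).obj Y)).cofiltered G

variable {Y G} [∀ a b : A, Finite (a ⟶ b)]

omit [HasFiniteLimits C] in
/-- A family of maps into a product diagram that is natural gives a transformation. -/
theorem exists_lift_of_isLimit_fan {T : A ⥤ P} {R : A ⥤ C} {a : A} {c : C}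
    (π : ∀ b, (b ⟶ a) → (R.obj b ⟶ c))
    (hπ : ∀ {b b' : A} (f : b ⟶ b') (g : b' ⟶ a), R.map f ≫ π b' g = π b (f ≫ g))
    (l : ∀ b, IsLimit (Fan.mk (R.obj b) (π b))) (p : T.obj a ⟶ Y.obj c) :
    ∃ k : T ⟶ R ⋙ Y, ∀ (b : A) (g : b ⟶ a), k.app b ≫ Y.map (π b g) = T.map g ≫ p := by
  -- The products are indexed by the finite hom-sets of `A`, so `Y` preserves them.
  let m : ∀ b, IsLimit (Fan.mk (Y.obj (R.obj b)) fun g => Y.map (π b g)) :=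
    fun b => isLimitFanMkObjOfIsLimit Y _ _ (l b)
  have fac : ∀ (b : A) (g : b ⟶ a),
      Fan.IsLimit.lift (m b) (fun g => T.map g ≫ p) ≫ Y.map (π b g) = T.map g ≫ p :=
    fun b g => Fan.IsLimit.fac (m b) (fun g => T.map g ≫ p) g
  refine ⟨{ app := fun b => Fan.IsLimit.lift (m b) (fun g => T.map g ≫ p)
            naturality := fun b b' f => ?_ }, fac⟩
  refine Fan.IsLimit.hom_ext (m b') _ _ (fun g => ?_)
  change (T.map f ≫ Fan.IsLimit.lift (m b') (fun g => T.map g ≫ p)) ≫ Y.map (π b' g) =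
    (Fan.IsLimit.lift (m b) (fun g => T.map g ≫ p) ≫ Y.map (R.map f)) ≫ Y.map (π b' g)
  rw [Category.assoc, fac, Category.assoc, ← Y.map_comp, hπ, fac, T.map_comp, Category.assoc]

/-- The right adjoint of evaluation at `a`, applied to `c`. -/
theorem exists_cofree (a : A) (c : C) :
    ∃ (R : A ⥤ C) (π : ∀ b, (b ⟶ a) → (R.obj b ⟶ c)),
      (∀ {b b' : A} (f : b ⟶ b') (g : b' ⟶ a), R.map f ≫ π b' g = π b (f ≫ g)) ∧
      ∀ b, Nonempty (IsLimit (Fan.mk (R.obj b) (π b))) :=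
  ⟨(evaluationRightAdjoint C a).obj c, fun b g => Pi.π (fun _ : b ⟶ a => c) g,
    fun _ g => Pi.lift_π _ g, fun _ => ⟨productIsProduct _⟩⟩

/-- The cofree functor on `c` at `a` remains cofree after applying `Y`. The transpose of `p` is thus
an approximation of `G`, and projecting to the factor of `𝟙 a` recovers `p`. -/
theorem Approx.exists_fac {a : A} {c : C} (p : G.obj a ⟶ Y.obj c) :
    ∃ (T : Approx Y G) (h : T.right.obj a ⟶ c), T.hom.app a ≫ Y.map h = p := by
  obtain ⟨R, π, hπ, l⟩ := exists_cofree a c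
  obtain ⟨η, hη⟩ := exists_lift_of_isLimit_fan π hπ (fun b => (l b).some) p
  refine ⟨StructuredArrow.mk (Y := R) η, π a (𝟙 a), (hη a (𝟙 a)).trans ?_⟩
  rw [G.map_id, Category.id_comp]

/-- The transposes of `h₁` and `h₂` into the cofree functor agree on `G`, so `G` factors through the
image under `Y` of their equalizer. The refinement is that equalizer, hence monic at every object.
-/
theorem Approx.exists_mono_eq {a : A} {c : C} (T : Approx Y G) (h₁ h₂ : T.right.obj a ⟶ c)
    (h : T.hom.app a ≫ Y.map h₁ = T.hom.app a ≫ Y.map h₂) :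
    ∃ (T' : Approx Y G) (j : T' ⟶ T), (∀ b, Mono (j.right.app b)) ∧
      j.right.app a ≫ h₁ = j.right.app a ≫ h₂ := by
  obtain ⟨R, π, hπ, l⟩ := exists_cofree a c
  -- With the identity of `C` in place of `Y`, the lifting lemma yields transposes inside `C`.
  obtain ⟨k₁, hk₁⟩ := exists_lift_of_isLimit_fan (Y := 𝟭 C) π hπ (fun b => (l b).some) h₁
  obtain ⟨k₂, hk₂⟩ := exists_lift_of_isLimit_fan (Y := 𝟭 C) π hπ (fun b => (l b).some) h₂
  replace hk₁ : ∀ b g, k₁.app b ≫ π b g = T.right.map g ≫ h₁ := hk₁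
  replace hk₂ : ∀ b g, k₂.app b ≫ π b g = T.right.map g ≫ h₂ := hk₂
  change T.right ⟶ R at k₁ k₂
  let Y' := (Functor.whiskeringRight A C P).obj Y
  have : PreservesFiniteLimits Y' := ⟨fun J _ _ => inferInstance⟩
  have w : T.hom ≫ Y'.map k₁ = T.hom ≫ Y'.map k₂ := by
    ext b
    refine Fan.IsLimit.hom_ext (isLimitFanMkObjOfIsLimit Y _ _ (l b).some) _ _ (fun g => ?_)
    change (T.hom.app b ≫ Y.map (k₁.app b)) ≫ Y.map (π b g) =
      (T.hom.app b ≫ Y.map (k₂.app b)) ≫ Y.map (π b g)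
    have n : T.hom.app b ≫ Y.map (T.right.map g) = G.map g ≫ T.hom.app a :=
      (T.hom.naturality g).symm
    rw [Category.assoc, Category.assoc, ← Y.map_comp, ← Y.map_comp]
    erw [hk₁, hk₂]
    rw [Y.map_comp, Y.map_comp, reassoc_of% n, reassoc_of% n, h]
  let l := isLimitForkMapOfIsLimit Y' (equalizer.condition k₁ k₂) (equalizerIsEqualizer k₁ k₂)
  let η : G ⟶ Y'.obj (equalizer k₁ k₂) := Fork.IsLimit.lift l T.hom w
  refine ⟨StructuredArrow.mk (Y := equalizer k₁ k₂) η,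
    StructuredArrow.homMk (equalizer.ι k₁ k₂) (Fork.IsLimit.lift_ι l), fun b => ?_, ?_⟩
  · exact (NatTrans.mono_iff_mono_app (equalizer.ι k₁ k₂)).1 inferInstance b
  · have e := congrArg (fun m => m.app a ≫ π a (𝟙 a)) (equalizer.condition k₁ k₂)
    have e₁ := hk₁ a (𝟙 a)
    have e₂ := hk₂ a (𝟙 a)
    rw [T.right.map_id, Category.id_comp] at e₁ e₂
    rw [← e₁, ← e₂]
    exact (Category.assoc _ _ _).symm.trans (e.trans (Category.assoc _ _ _))

/-! ### Approximations that are invertible at finitely many given objects -/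

variable [Y.Full] [Y.Faithful]

omit [HasFiniteLimits C] [PreservesFiniteLimits Y] [∀ a b : A, Finite (a ⟶ b)] in
-- By fullness the component of `T'` at `s` comes from `C`, up to `i`. This makes `j` a split epi at
-- `s`, and it is also monic there.
theorem Approx.isIso_app_of_mono {T T' : Approx Y G} (j : T' ⟶ T) {s : A}
    [Mono (j.right.app s)] {c : C} (i : G.obj s ≅ Y.obj c) [IsIso (T.hom.app s)] :
    IsIso (T'.hom.app s) := by
  obtain ⟨e, he⟩ := Y.map_surjective (i.inv ≫ T'.hom.app s)
  have hj : T'.hom.app s ≫ Y.map (j.right.app s) = T.hom.app s :=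
    congrArg (fun m => m.app s) (StructuredArrow.w j)
  have : IsIso (Y.map (e ≫ j.right.app s)) := by
    rw [Y.map_comp, he, Category.assoc, hj]
    infer_instance
  have : IsIso (e ≫ j.right.app s) := isIso_of_reflects_iso _ Y
  have : IsSplitEpi (j.right.app s) := ⟨⟨⟨inv (e ≫ j.right.app s) ≫ e, by simp⟩⟩⟩
  have : IsIso (j.right.app s) := isIso_of_mono_of_isSplitEpi _
  have : T'.hom.app s = T.hom.app s ≫ inv (Y.map (j.right.app s)) := by simp [← hj]
  rw [this]
  infer_instance

omit [HasFiniteLimits C] [PreservesFiniteLimits Y] [∀ a b : A, Finite (a ⟶ b)]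
  [Y.Full] [Y.Faithful] in
-- Split monos persist under arbitrary refinements, whereas invertibility is only kept along
-- refinements that are monic.
theorem Approx.isSplitMono_app_of_hom {T T' : Approx Y G} (j : T' ⟶ T) {s : A}
    [IsSplitMono (T.hom.app s)] : IsSplitMono (T'.hom.app s) := by
  have hj : T'.hom.app s ≫ Y.map (j.right.app s) = T.hom.app s :=
    congrArg (fun m => m.app s) (StructuredArrow.w j)
  refine ⟨⟨⟨Y.map (j.right.app s) ≫ retraction (T.hom.app s), ?_⟩⟩⟩
  rw [reassoc_of% hj, IsSplitMono.id]

omit [Y.Full] [Y.Faithful] in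
-- An approximation through which `i.hom` factors is split monic at `s`; take a common refinement of
-- it with `T`.
theorem Approx.exists_isSplitMono (T : Approx Y G) {s : A} {c : C} (i : G.obj s ≅ Y.obj c) :
    ∃ (T' : Approx Y G) (_ : T' ⟶ T), IsSplitMono (T'.hom.app s) := by
  obtain ⟨T₀, h, hh⟩ := Approx.exists_fac (Y := Y) i.hom
  have : IsSplitMono (T₀.hom.app s) := ⟨⟨⟨Y.map h ≫ i.inv, by rw [reassoc_of% hh, i.hom_inv_id]⟩⟩⟩
  exact ⟨IsCofiltered.min T T₀, IsCofiltered.minToLeft T T₀,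
    Approx.isSplitMono_app_of_hom (IsCofiltered.minToRight T T₀)⟩

omit [Y.Faithful] in
-- The retraction followed by the component of `T` is an idempotent that lifts to `r ≫ e` in `C`.
-- Once a refinement equalizes this idempotent with the identity, the retraction becomes a two-sided
-- inverse.
theorem Approx.exists_isIso (T : Approx Y G) {s : A} {c : C} (i : G.obj s ≅ Y.obj c)
    [IsSplitMono (T.hom.app s)] :
    ∃ (T' : Approx Y G) (j : T' ⟶ T), (∀ b, Mono (j.right.app b)) ∧ IsIso (T'.hom.app s) := by
  obtain ⟨r, hr⟩ := Y.map_surjective (retraction (T.hom.app s) ≫ i.hom)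
  obtain ⟨e, he⟩ := Y.map_surjective (i.inv ≫ T.hom.app s)
  have hre : Y.map (r ≫ e) = retraction (T.hom.app s) ≫ T.hom.app s := by
    rw [Y.map_comp, hr, he, Category.assoc, i.hom_inv_id_assoc]
  obtain ⟨T', j, hmono, hj⟩ := Approx.exists_mono_eq T (r ≫ e) (𝟙 _) (by
    rw [hre, IsSplitMono.id_assoc, Y.map_id]
    exact (Category.comp_id _).symm)
  refine ⟨T', j, hmono, ?_⟩
  have := hmono s
  have hj' : T'.hom.app s ≫ Y.map (j.right.app s) = T.hom.app s :=
    congrArg (fun m => m.app s) (StructuredArrow.w j)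
  refine ⟨Y.map (j.right.app s) ≫ retraction (T.hom.app s), ?_, ?_⟩
  · rw [reassoc_of% hj', IsSplitMono.id]
  · have hm : Mono (Y.map (j.right.app s)) := inferInstance
    rw [← cancel_mono (Y.map (j.right.app s)), Category.assoc, Category.assoc, hj', ← hre,
      ← Y.map_comp, hj, Category.comp_id]
    exact (Category.id_comp _).symm

/-- Two rounds are needed. All components are made split monic first, by arbitrary refinements; then
they are made invertible one at a time by monic refinements, which do not spoil those already
treated. -/
theorem Approx.exists_isIso_of_finite (T : Approx Y G) {s : Set A} (hs : s.Finite)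
    (i : ∀ a ∈ s, ∃ c, Nonempty (G.obj a ≅ Y.obj c)) :
    ∃ (T' : Approx Y G) (_ : T' ⟶ T), ∀ a ∈ s, IsIso (T'.hom.app a) := by
  obtain ⟨T₁, j₁, h₁⟩ : ∃ (T' : Approx Y G) (_ : T' ⟶ T), ∀ a ∈ s, IsSplitMono (T'.hom.app a) := by
    induction s, hs using Set.Finite.induction_on with
    | empty => exact ⟨T, 𝟙 T, fun a ha => ha.elim⟩
    | @insert a s _ _ ih =>
      obtain ⟨T₁, j₁, h₁⟩ := ih (fun b hb => i b (Set.mem_insert_of_mem a hb))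
      obtain ⟨c, ⟨k⟩⟩ := i a (Set.mem_insert a s)
      obtain ⟨T₂, j₂, h₂⟩ := Approx.exists_isSplitMono T₁ k
      refine ⟨T₂, j₂ ≫ j₁, ?_⟩
      rintro b (rfl | hb)
      · exact h₂
      · have := h₁ b hb
        exact Approx.isSplitMono_app_of_hom j₂
  obtain ⟨T', j, h⟩ : ∃ (T' : Approx Y G) (_ : T' ⟶ T₁), ∀ a ∈ s, IsIso (T'.hom.app a) := by
    induction s, hs using Set.Finite.induction_on with
    | empty => exact ⟨T₁, 𝟙 T₁, fun a ha => ha.elim⟩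
    | @insert a s _ _ ih =>
      obtain ⟨T₂, j₂, h₂⟩ := ih (fun b hb => i b (Set.mem_insert_of_mem a hb))
        (fun b hb => h₁ b (Set.mem_insert_of_mem a hb))
      obtain ⟨c, ⟨k⟩⟩ := i a (Set.mem_insert a s)
      have := h₁ a (Set.mem_insert a s)
      have : IsSplitMono (T₂.hom.app a) := Approx.isSplitMono_app_of_hom j₂
      obtain ⟨T₃, j₃, hm, h₃⟩ := Approx.exists_isIso T₂ k
      refine ⟨T₃, j₃ ≫ j₂, ?_⟩
      rintro b (rfl | hb)
      · exact h₃
      · have := h₂ b hb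
        have := hm b
        obtain ⟨d, ⟨k'⟩⟩ := i b (Set.mem_insert_of_mem a hb)
        exact Approx.isIso_app_of_mono j₃ k'
  exact ⟨T', j ≫ j₁, h⟩

end Approximation

/-! ### Limits and colimits in the pro-completion -/

section ProCompletion

variable {C : Type u} [SmallCategory C]

theorem homYEquiv_precomp {P Q : ProCompletion C} {c : C} (m : P ⟶ Q) (p : Q ⟶ (y C).obj c) :
    homYEquiv P c (m ≫ p) = m.unop.hom.app c (homYEquiv Q c p) := rfl

/-- A morphism `P ⟶ Q` of the pro-completion is a natural transformation from the functor
`hom (Q, y -)` to the functor `hom (P, y -)`. -/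
theorem existsUnique_hom {P Q : ProCompletion C}
    (φ : ∀ c : C, (Q ⟶ (y C).obj c) → (P ⟶ (y C).obj c))
    (hφ : ∀ (c d : C) (f : c ⟶ d) (p : Q ⟶ (y C).obj c),
      φ d (p ≫ (y C).map f) = φ c p ≫ (y C).map f) :
    ∃! m : P ⟶ Q, ∀ (c : C) (p : Q ⟶ (y C).obj c), m ≫ p = φ c p := by
  refine ⟨Quiver.Hom.op (ObjectProperty.homMk
    { app := fun c => TypeCat.ofHom fun x => homYEquiv P c (φ c ((homYEquiv Q c).symm x))
      naturality := fun c d f => ?_ }), fun c p => ?_, fun m hm => ?_⟩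
  · ext x
    change homYEquiv P d (φ d ((homYEquiv Q d).symm (Q.unop.obj.map f x))) =
      P.unop.obj.map f (homYEquiv P c (φ c ((homYEquiv Q c).symm x)))
    rw [← homYEquiv_comp, ← hφ]
    congr 2
    rw [Equiv.symm_apply_eq, homYEquiv_comp, Equiv.apply_symm_apply]
  · apply (homYEquiv P c).injective
    change homYEquiv P c (φ c ((homYEquiv Q c).symm (homYEquiv Q c p))) = _
    rw [Equiv.symm_apply_apply]
  · apply Quiver.Hom.unop_inj
    ext c x
    obtain ⟨p, rfl⟩ := (homYEquiv Q c).surjective x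
    change _ = homYEquiv P c (φ c ((homYEquiv Q c).symm (homYEquiv Q c p)))
    rw [Equiv.symm_apply_apply, ← hm, homYEquiv_precomp]
    rfl

theorem hom_ext_y {P Q : ProCompletion C} {m n : P ⟶ Q}
    (h : ∀ (c : C) (p : Q ⟶ (y C).obj c), m ≫ p = n ≫ p) : m = n :=
  (existsUnique_hom (fun _ p => n ≫ p) (fun _ _ _ _ => (Category.assoc _ _ _).symm)).unique
    h (fun _ _ => rfl)

/-- Colimits of graph-shaped diagrams in the pro-completion are tested on the objects `y c`. -/
theorem isGraphColimit_of_y {H : Type} [Quiver.{0} H] {D : H ⥤q ProCompletion C}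
    {P : ProCompletion C} {k : ∀ h, D.obj h ⟶ P}
    (w : ∀ {a b : H} (e : a ⟶ b), D.map e ≫ k b = k a)
    (hk : ∀ (c : C) (t : ∀ h, D.obj h ⟶ (y C).obj c),
      (∀ {a b : H} (e : a ⟶ b), D.map e ≫ t b = t a) →
        ∃! f : P ⟶ (y C).obj c, ∀ h, k h ≫ f = t h) :
    IsGraphColimit D P k := by
  refine ⟨w, fun T t ht => ?_⟩
  choose d hd hu using fun (c : C) (p : T ⟶ (y C).obj c) =>
    hk c (fun h => t h ≫ p) (fun e => by rw [← Category.assoc, ht])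
  obtain ⟨f, hf, hfu⟩ := existsUnique_hom d (fun c c' g p => by
    refine (hu c' _ _ (fun h => ?_)).symm
    rw [← Category.assoc, hd, Category.assoc])
  refine ⟨f, fun h => hom_ext_y fun c p => ?_, fun g hg => hfu g fun c p => ?_⟩
  · rw [Category.assoc, hf, hd]
  · exact hu c p _ fun h => by rw [← Category.assoc, hg]

theorem homYEquiv_map {c d : C} (f : c ⟶ d) :
    homYEquiv ((y C).obj c) d ((y C).map f) = f :=
  Category.comp_id f

instance : (y C).Faithful where
  map_injective {c d} f g h :=
    (homYEquiv_map f).symm.trans ((congrArg (homYEquiv ((y C).obj c) d) h).trans (homYEquiv_map g))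

instance : (y C).Full where
  map_surjective {c d} m := ⟨homYEquiv ((y C).obj c) d m,
    (homYEquiv ((y C).obj c) d).injective (homYEquiv_map (C := C) _)⟩

/-- A functor and its underlying morphism of graphs have the same cones. -/
theorem isGraphLimit_of_isLimit {D : Type u'} [Category.{v'} D] {J : Type} [Category.{0} J]
    {K : J ⥤ D} {c : Cone K} (hc : IsLimit c) :
    IsGraphLimit K.toPrefunctor c.pt (fun j => c.π.app j) := by
  refine ⟨fun e => c.w e, fun T t ht => ?_⟩
  let s : Cone K :=
    { pt := T
      π := { app := t
             naturality := fun a b e => Eq.trans (Category.id_comp (t b)) (ht e).symm } }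
  exact ⟨hc.lift s, fun j => hc.fac s j, fun f hf => hc.uniq s f hf⟩

instance : PreservesFiniteLimits (y C) where
  preservesFiniteLimits J _ _ := ⟨fun {K} => ⟨fun {c} hc => by
    have h := (isGraphLimit_of_isLimit hc).map_y
    choose lift fac uniq using fun s : Cone (K ⋙ y C) =>
      h.existsUnique_lift s.pt (fun j => s.π.app j) (fun e => s.w e)
    exact ⟨{ lift := lift, fac := fac, uniq := uniq }⟩⟩⟩

/-! ### Recognition of cofiltered limits by maps into the objects `y d` -/

section Cofiltered

variable {J : Type u'} [Category.{v'} J] [IsCofiltered J] {W : J ⥤ C}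

/-- A cone over a cofiltered diagram of objects `y (W i)` has the universal property with respect
to the objects `y d` which characterizes cofiltered limits in the pro-completion. -/
structure IsProLimit (c : Cone (W ⋙ y C)) : Prop where
  exists_fac {d : C} (p : c.pt ⟶ (y C).obj d) :
    ∃ (i : J) (h : W.obj i ⟶ d), c.π.app i ≫ (y C).map h = p
  exists_eq {i : J} {d : C} (h₁ h₂ : W.obj i ⟶ d)
    (h : c.π.app i ≫ (y C).map h₁ = c.π.app i ≫ (y C).map h₂) :
    ∃ (j : J) (f : j ⟶ i), W.map f ≫ h₁ = W.map f ≫ h₂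

/-- The hypothesis says that maps from the apex to `y d` form the filtered colimit of the sets of
maps `W i ⟶ d`. A cone `s` sends a map factored through stage `i` to the leg of `s` at `i` followed
by the same factor; `existsUnique_hom` turns this assignment into a morphism. -/
theorem IsProLimit.nonempty_isLimit {c : Cone (W ⋙ y C)} (hc : IsProLimit c) :
    Nonempty (IsLimit c) := by
  have w : ∀ (s : Cone (W ⋙ y C)) {i j : J} (f : i ⟶ j),
      s.π.app i ≫ (y C).map (W.map f) = s.π.app j := fun s i j f => s.w f
  choose i h hf using fun (d : C) (p : c.pt ⟶ (y C).obj d) => hc.exists_fac p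
  -- Independence of the chosen factorization: two factorizations of one map already agree at a
  -- further stage of the diagram.
  have key : ∀ (s : Cone (W ⋙ y C)) {i j : J} {d : C} (h : W.obj i ⟶ d) (g : W.obj j ⟶ d),
      c.π.app i ≫ (y C).map h = c.π.app j ≫ (y C).map g →
      s.π.app i ≫ (y C).map h = s.π.app j ≫ (y C).map g := by
    intro s i j d h g e
    obtain ⟨k, a, b, -⟩ := IsCofilteredOrEmpty.cone_objs i j
    rw [← w c a, ← w c b, Category.assoc, Category.assoc, ← Functor.map_comp,
      ← Functor.map_comp] at e
    obtain ⟨l, f, hl⟩ := hc.exists_eq _ _ e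
    rw [← w s a, ← w s b, ← w s f]
    simp only [Category.assoc]
    rw [← Functor.map_comp, ← Functor.map_comp, ← Functor.map_comp, ← Functor.map_comp, hl]
  choose lift hlift hu using fun s : Cone (W ⋙ y C) =>
    existsUnique_hom (P := s.pt) (Q := c.pt)
      (fun d p => s.π.app (i d p) ≫ (y C).map (h d p)) (fun d d' f p => by
        rw [Category.assoc, ← Functor.map_comp]
        refine key s _ _ ?_
        rw [hf, Functor.map_comp, ← Category.assoc, hf])
  have fac : ∀ (s : Cone (W ⋙ y C)) (j : J), lift s ≫ c.π.app j = s.π.app j := fun s j => by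
    have := key s (h _ (c.π.app j)) (𝟙 _) (by
      rw [hf, (y C).map_id]
      exact (Category.comp_id _).symm)
    refine (hlift s (W.obj j) (c.π.app j)).trans (this.trans ?_)
    rw [(y C).map_id]
    exact Category.comp_id _
  exact ⟨{ lift := lift
           fac := fac
           uniq := fun s m hm => hu s m fun d p => by
             conv_lhs => rw [← hf d p]
             rw [← Category.assoc, hm] }⟩

end Cofiltered

/-! ### Existence and exactness of small cofiltered limits in the pro-completion -/

section Small

variable {J : Type u} [SmallCategory J] [IsCofiltered J]

/-- Finite limits commute with filtered colimits in `Type u`. -/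
instance : (leftExactFunctor C (Type u)).IsClosedUnderColimitsOfShape Jᵒᵖ :=
  inferInstanceAs (ObjectProperty.IsClosedUnderColimitsOfShape
    (ObjectProperty.preservesFiniteLimits : ObjectProperty (C ⥤ Type u)) Jᵒᵖ)

instance : HasLimitsOfShape J (ProCompletion C) := by
  have : HasColimitsOfShape Jᵒᵖ (C ⥤ₗ Type u) :=
    inferInstanceAs (HasColimitsOfShape Jᵒᵖ (leftExactFunctor C (Type u)).FullSubcategory)
  exact hasLimitsOfShape_op_of_hasColimitsOfShape

/-- Dually, filtered colimits of left exact functors are computed pointwise. The two conditions are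
the usual descriptions of elements and of equality in a filtered colimit of sets. -/
theorem isProLimit_of_isLimit {W : J ⥤ C} {c : Cone (W ⋙ y C)} (hc : IsLimit c) :
    IsProLimit c := by
  have h₁ : IsColimit (coconeLeftOpOfCone c) := isColimitCoconeLeftOpOfCone _ hc
  have h₂ : ∀ d : C, IsColimit (((leftExactFunctor C (Type u)).ι ⋙
      (evaluation C (Type u)).obj d).mapCocone (coconeLeftOpOfCone c)) := fun d =>
    isColimitOfPreserves _ h₁
  constructor
  · intro d p
    obtain ⟨i, x, hx⟩ := Types.jointly_surjective _ (h₂ d) (homYEquiv _ d p)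
    change W.obj i.unop ⟶ d at x
    refine ⟨i.unop, x, (homYEquiv c.pt d).injective (Eq.trans ?_ hx)⟩
    exact congrArg (fun z => (c.π.app i.unop).unop.hom.app d z) (homYEquiv_map x)
  · intro i d f g e
    have e' : (c.π.app i).unop.hom.app d f = (c.π.app i).unop.hom.app d g := by
      have e₁ := congrArg (homYEquiv c.pt d) e
      have e₂ : ∀ f : W.obj i ⟶ d, homYEquiv c.pt d (c.π.app i ≫ (y C).map f) =
          (c.π.app i).unop.hom.app d f := fun f =>
        congrArg (fun z => (c.π.app i).unop.hom.app d z) (homYEquiv_map f)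
      exact (e₂ f).symm.trans (e₁.trans (e₂ g))
    obtain ⟨j, a, ha⟩ := (Types.FilteredColimit.isColimit_eq_iff' (h₂ d) (i := op i) f g).1 e'
    exact ⟨j.unop, a.unop, ha⟩

/-- The functor which sends a diagram in `C` to its limit in the pro-completion. -/
noncomputable def proLim (C : Type u) [SmallCategory C] (J : Type u) [SmallCategory J]
    [IsCofiltered J] : (J ⥤ C) ⥤ ProCompletion C :=
  (Functor.whiskeringRight J C (ProCompletion C)).obj (y C) ⋙ lim

/-- The projection from the limit of a diagram. -/
noncomputable def proLimπ (W : J ⥤ C) (j : J) : (proLim C J).obj W ⟶ (y C).obj (W.obj j) :=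
  limit.π (W ⋙ y C) j

theorem proLimπ_map (W : J ⥤ C) {i j : J} (f : i ⟶ j) :
    proLimπ W i ≫ (y C).map (W.map f) = proLimπ W j :=
  limit.w (W ⋙ y C) f

theorem proLim_map_π {V W : J ⥤ C} (m : V ⟶ W) (j : J) :
    (proLim C J).map m ≫ proLimπ W j = proLimπ V j ≫ (y C).map (m.app j) :=
  limMap_π _ j

theorem proLim_exists_fac (W : J ⥤ C) {d : C} (p : (proLim C J).obj W ⟶ (y C).obj d) :
    ∃ (i : J) (h : W.obj i ⟶ d), proLimπ W i ≫ (y C).map h = p :=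
  (isProLimit_of_isLimit (limit.isLimit (W ⋙ y C))).exists_fac p

theorem proLim_exists_eq (W : J ⥤ C) {i : J} {d : C} (h₁ h₂ : W.obj i ⟶ d)
    (h : proLimπ W i ≫ (y C).map h₁ = proLimπ W i ≫ (y C).map h₂) :
    ∃ (j : J) (f : j ⟶ i), W.map f ≫ h₁ = W.map f ≫ h₂ :=
  (isProLimit_of_isLimit (limit.isLimit (W ⋙ y C))).exists_eq h₁ h₂ h

theorem exists_hom_of_finite {ι : Type*} [Finite ι] (i : ι → J) :
    ∃ j : J, ∀ k, Nonempty (j ⟶ i k) := by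
  classical
  have := Fintype.ofFinite ι
  obtain ⟨j, hj⟩ := IsCofiltered.inf_objs_exists (Finset.univ.image i)
  exact ⟨j, fun k => hj (Finset.mem_image_of_mem i (Finset.mem_univ k))⟩

/-- Cofiltered limits in the pro-completion preserve the finite colimits of `C`. -/
theorem isGraphColimit_proLim {H : Type} [Quiver.{0} H] [Finite H] [∀ a b : H, Finite (a ⟶ b)]
    {D : H ⥤q (J ⥤ C)} {W : J ⥤ C} {k : ∀ h, D.obj h ⟶ W}
    (hk : ∀ j, IsGraphColimit (D ⋙q ((evaluation J C).obj j).toPrefunctor) (W.obj j)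
      (fun h => (k h).app j)) :
    IsGraphColimit (D ⋙q (proLim C J).toPrefunctor) ((proLim C J).obj W)
      (fun h => (proLim C J).map (k h)) := by
  have hw : ∀ {a b : H} (e : a ⟶ b), D.map e ≫ k b = k a := fun e => by
    ext j
    exact (hk j).w e
  refine isGraphColimit_of_y
    (fun e => ((proLim C J).map_comp _ _).symm.trans (congrArg (proLim C J).map (hw e)))
    fun c t ht => ?_
  change ∀ h, (proLim C J).obj (D.obj h) ⟶ (y C).obj c at t
  replace ht : ∀ {a b : H} (e : a ⟶ b), (proLim C J).map (D.map e) ≫ t b = t a := ht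
  refine existsUnique_of_exists_of_unique ?_ ?_
  -- Each leg of the cocone lives at some stage; as there are finitely many vertices, all legs live
  -- at a common stage `i`.
  · choose i₀ x₀ hx₀ using fun h => proLim_exists_fac (D.obj h) (t h)
    obtain ⟨i, hi⟩ := exists_hom_of_finite i₀
    let x : ∀ h, (D.obj h).obj i ⟶ c := fun h => (D.obj h).map (hi h).some ≫ x₀ h
    have hx : ∀ h, proLimπ (D.obj h) i ≫ (y C).map (x h) = t h := fun h => by
      rw [Functor.map_comp, ← Category.assoc, proLimπ_map, hx₀]
    -- Compatibility with each edge holds after a refinement. With finitely many edges, one stage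
    -- `j` serves for all, and the colimit in `C` at `j` provides the descent.
    have heq : ∀ e : (Σ a b : H, (a ⟶ b)), ∃ (j : J) (f : j ⟶ i),
        (D.obj e.1).map f ≫ (D.map e.2.2).app i ≫ x e.2.1 = (D.obj e.1).map f ≫ x e.1 := by
      rintro ⟨a, b, e⟩
      refine proLim_exists_eq _ _ _ ?_
      dsimp only
      rw [Functor.map_comp, ← Category.assoc, ← proLim_map_π, Category.assoc, hx, hx, ht]
    choose j₀ f₀ hf₀ using heq
    obtain ⟨j, f, g, hg⟩ := IsCofiltered.wideCospan f₀
    obtain ⟨d, hd, -⟩ := (hk j).existsUnique_desc c (fun h => (D.obj h).map f ≫ x h)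
      (fun {a b} e => by
        have h₁ := congrArg (fun m => (D.obj a).map (g ⟨a, b, e⟩) ≫ m) (hf₀ ⟨a, b, e⟩)
        dsimp only at h₁
        rw [← Category.assoc, ← Functor.map_comp, hg, ← Category.assoc ((D.obj a).map (g _)),
          ← Functor.map_comp, hg] at h₁
        refine Eq.trans ?_ h₁
        exact (Category.assoc _ _ _).symm.trans
          ((congrArg (fun m => m ≫ x b) ((D.map e).naturality f).symm).trans
            (Category.assoc _ _ _)))
    refine ⟨proLimπ W j ≫ (y C).map d, fun h => ?_⟩
    have hd' : (k h).app j ≫ d = (D.obj h).map f ≫ x h := hd h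
    have e : (proLim C J).map (k h) ≫ proLimπ W j ≫ (y C).map d = t h := by
      rw [← Category.assoc, proLim_map_π, Category.assoc, ← Functor.map_comp, hd',
        Functor.map_comp, ← Category.assoc, proLimπ_map, hx]
    exact e
  · intro p q hp hq
    replace hp : ∀ h, (proLim C J).map (k h) ≫ p = t h := hp
    replace hq : ∀ h, (proLim C J).map (k h) ≫ q = t h := hq
    obtain ⟨i₁, p, rfl⟩ := proLim_exists_fac W p
    obtain ⟨i₂, q, rfl⟩ := proLim_exists_fac W q
    obtain ⟨i, f₁, f₂, -⟩ := IsCofilteredOrEmpty.cone_objs i₁ i₂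
    -- Two candidates brought to a common stage agree on each vertex after a refinement; finiteness
    -- again gives a stage where uniqueness in `C` applies.
    have heq : ∀ h : H, ∃ (j : J) (f : j ⟶ i),
        (D.obj h).map f ≫ (k h).app i ≫ W.map f₁ ≫ p =
          (D.obj h).map f ≫ (k h).app i ≫ W.map f₂ ≫ q := fun h => by
      refine proLim_exists_eq _ _ _ ?_
      rw [Functor.map_comp, ← Category.assoc, ← proLim_map_π, Category.assoc,
        Functor.map_comp, ← Category.assoc (proLimπ W i), proLimπ_map, hp,
        Functor.map_comp, ← Category.assoc (proLimπ _ i), ← proLim_map_π, Category.assoc,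
        Functor.map_comp, ← Category.assoc (proLimπ W i), proLimπ_map, hq]
    choose j₀ f₀ hf₀ using heq
    obtain ⟨j, f, g, hg⟩ := IsCofiltered.wideCospan f₀
    have hj : ∀ h, (k h).app j ≫ W.map f ≫ W.map f₁ ≫ p =
        (k h).app j ≫ W.map f ≫ W.map f₂ ≫ q := fun h => by
      have h₁ := congrArg (fun m => (D.obj h).map (g h) ≫ m) (hf₀ h)
      rw [← Category.assoc, ← Functor.map_comp, hg, ← Category.assoc ((D.obj h).map (g _)),
          ← Functor.map_comp, hg] at h₁
      rw [← Category.assoc, ← (k h).naturality, Category.assoc, h₁, ← Category.assoc,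
        (k h).naturality, Category.assoc]
    have := ((hk j).existsUnique_desc c (fun h => (k h).app j ≫ W.map f ≫ W.map f₂ ≫ q)
      (fun {a b} e => by
        refine (Category.assoc _ _ _).symm.trans ?_
        exact congrArg (fun m => m ≫ W.map f ≫ W.map f₂ ≫ q) ((hk j).w e))).unique
      hj (fun h => rfl)
    rw [← proLimπ_map W f₁, ← proLimπ_map W f₂, ← proLimπ_map W f]
    simp only [Category.assoc]
    rw [← Functor.map_comp, ← Functor.map_comp, ← Functor.map_comp, ← Functor.map_comp, this]

/-- Limits of graph-shaped diagrams of functors are computed pointwise. -/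
theorem isGraphLimit_of_pointwise {E : Type*} [Category* E] {D' : Type*} [Category* D'] {H : Type}
    [Quiver.{0} H] {D : H ⥤q (E ⥤ D')} {W : E ⥤ D'} {k : ∀ h, W ⟶ D.obj h}
    (hk : ∀ j, IsGraphLimit (D ⋙q ((evaluation E D').obj j).toPrefunctor) (W.obj j)
      (fun h => (k h).app j)) :
    IsGraphLimit D W k := by
  refine ⟨fun e => by ext j; exact (hk j).w e, fun T t ht => ?_⟩
  choose l hl hu using fun j => (hk j).existsUnique_lift (T.obj j) (fun h => (t h).app j)
    (fun e => congrArg (fun m => m.app j) (ht e))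
  replace hl : ∀ j h, l j ≫ (k h).app j = (t h).app j := hl
  refine ⟨{ app := l, naturality := fun i j f => ?_ }, fun h => by ext j; exact hl j h,
    fun g hg => by ext j; exact hu j _ fun h => congrArg (fun m => m.app j) (hg h)⟩
  -- Naturality of the pointwise lifts: both sides are lifts of the same cone to `W.obj j`.
  refine ((hk j).existsUnique_lift (T.obj i) (fun h => (t h).app i ≫ (D.obj h).map f)
    (fun {a b} e => ?_)).unique (fun h => ?_) (fun h => ?_)
  · change ((t a).app i ≫ (D.obj a).map f) ≫ (D.map e).app j = (t b).app i ≫ (D.obj b).map f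
    rw [← ht e, Category.assoc, (D.map e).naturality, NatTrans.comp_app, Category.assoc]
  · change (T.map f ≫ l j) ≫ (k h).app j = (t h).app i ≫ (D.obj h).map f
    rw [Category.assoc, hl, (t h).naturality]
  · change (l i ≫ W.map f) ≫ (k h).app j = (t h).app i ≫ (D.obj h).map f
    rw [Category.assoc, (k h).naturality, ← Category.assoc, hl]

instance [HasFiniteLimits C] : PreservesFiniteLimits (proLim C J) := by
  have : PreservesFiniteLimits
      ((Functor.whiskeringRight J C (ProCompletion C)).obj (y C)) :=
    ⟨fun K _ _ => inferInstance⟩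
  have : PreservesFiniteLimits (lim : (J ⥤ ProCompletion C) ⥤ ProCompletion C) :=
    ⟨fun K _ _ => inferInstance⟩
  exact comp_preservesFiniteLimits _ _

/-- Cofiltered limits in the pro-completion preserve the finite limits of `C`. -/
theorem isGraphLimit_proLim [HasFiniteLimits C] {H : Type} [Quiver.{0} H] [Finite H]
    [∀ a b : H, Finite (a ⟶ b)]
    {D : H ⥤q (J ⥤ C)} {W : J ⥤ C} {k : ∀ h, W ⟶ D.obj h}
    (hk : ∀ j, IsGraphLimit (D ⋙q ((evaluation J C).obj j).toPrefunctor) (W.obj j)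
      (fun h => (k h).app j)) :
    IsGraphLimit (D ⋙q (proLim C J).toPrefunctor) ((proLim C J).obj W)
      (fun h => (proLim C J).map (k h)) :=
  (isGraphLimit_of_pointwise hk).map_of_preservesFiniteLimits (proLim C J)

end Small

end ProCompletion

/-! ### Transport of structures along isomorphisms -/

section Transport

variable {C : Type u} [Category.{v} C]

theorem composePath_naturality {V : Type} [Quiver.{0} V] {F G : V ⥤q C}
    (θ : ∀ a, F.obj a ⟶ G.obj a)
    (hθ : ∀ {a b : V} (e : a ⟶ b), F.map e ≫ θ b = θ a ≫ G.map e) {a b : V}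
    (p : Quiver.Path a b) :
    composePath (F.mapPath p) ≫ θ b = θ a ≫ composePath (G.mapPath p) := by
  induction p with
  | nil => exact (Category.id_comp _).trans (Category.comp_id _).symm
  | cons p e ih =>
    change (composePath (F.mapPath p) ≫ F.map e) ≫ θ _ =
      θ a ≫ composePath (G.mapPath p) ≫ G.map e
    rw [Category.assoc, hθ, ← Category.assoc, ih, Category.assoc]

theorem CommCond.Holds.of_iso {V : Type} [Quiver.{0} V] {F G : V ⥤q C}
    (θ : ∀ a, F.obj a ≅ G.obj a)
    (hθ : ∀ {a b : V} (e : a ⟶ b), F.map e ≫ (θ b).hom = (θ a).hom ≫ G.map e)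
    {c : CommCond V} (hc : c.Holds F) : c.Holds G := by
  unfold CommCond.Holds at hc ⊢
  rw [← cancel_epi (θ c.src).hom, ← composePath_naturality (fun a => (θ a).hom) hθ,
    ← composePath_naturality (fun a => (θ a).hom) hθ, hc]

theorem IsGraphLimit.of_iso {H : Type} [Quiver.{0} H] {D D' : H ⥤q C} {P P' : C}
    {c : ∀ h, P ⟶ D.obj h} {c' : ∀ h, P' ⟶ D'.obj h} (hc : IsGraphLimit D P c)
    (θ : ∀ h, D.obj h ≅ D'.obj h)
    (hθ : ∀ {a b : H} (e : a ⟶ b), D.map e ≫ (θ b).hom = (θ a).hom ≫ D'.map e)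
    (i : P ≅ P') (hi : ∀ h, c h ≫ (θ h).hom = i.hom ≫ c' h) : IsGraphLimit D' P' c' := by
  have hθ' : ∀ {a b : H} (e : a ⟶ b), D'.map e ≫ (θ b).inv = (θ a).inv ≫ D.map e := fun e => by
    rw [Iso.comp_inv_eq, Category.assoc, hθ, Iso.inv_hom_id_assoc]
  have hi' : ∀ h, c' h = i.inv ≫ c h ≫ (θ h).hom := fun h => by rw [hi, Iso.inv_hom_id_assoc]
  refine ⟨fun {a b} e => ?_, fun T t ht => ?_⟩
  · rw [hi', hi', Category.assoc, Category.assoc, ← hθ, ← Category.assoc (c a), hc.w]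
  · obtain ⟨f, hf, hu⟩ := hc.existsUnique_lift T (fun h => t h ≫ (θ h).inv) (fun {a b} e => by
      rw [Category.assoc, ← hθ', ← Category.assoc, ht])
    refine ⟨f ≫ i.hom, fun h => ?_, fun g hg => ?_⟩
    · rw [Category.assoc, ← hi, ← Category.assoc, hf, Category.assoc, Iso.inv_hom_id,
        Category.comp_id]
    · rw [← Iso.comp_inv_eq]
      refine hu _ fun h => ?_
      rw [Iso.eq_comp_inv, Category.assoc, Category.assoc, ← hi', hg]

theorem IsGraphColimit.of_iso {H : Type} [Quiver.{0} H] {D D' : H ⥤q C} {P P' : C}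
    {c : ∀ h, D.obj h ⟶ P} {c' : ∀ h, D'.obj h ⟶ P'} (hc : IsGraphColimit D P c)
    (θ : ∀ h, D.obj h ≅ D'.obj h)
    (hθ : ∀ {a b : H} (e : a ⟶ b), D.map e ≫ (θ b).hom = (θ a).hom ≫ D'.map e)
    (i : P ≅ P') (hi : ∀ h, c h ≫ i.hom = (θ h).hom ≫ c' h) : IsGraphColimit D' P' c' := by
  have hθ' : ∀ {a b : H} (e : a ⟶ b), D'.map e ≫ (θ b).inv = (θ a).inv ≫ D.map e := fun e => by
    rw [Iso.comp_inv_eq, Category.assoc, hθ, Iso.inv_hom_id_assoc]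
  have hi' : ∀ h, c' h = (θ h).inv ≫ c h ≫ i.hom := fun h => by rw [hi, Iso.inv_hom_id_assoc]
  refine ⟨fun {a b} e => ?_, fun T t ht => ?_⟩
  · rw [hi', hi', ← Category.assoc, hθ', Category.assoc, ← Category.assoc (D.map e), hc.w]
  · obtain ⟨f, hf, hu⟩ := hc.existsUnique_desc T (fun h => (θ h).hom ≫ t h) (fun {a b} e => by
      rw [← Category.assoc, hθ, Category.assoc, ht])
    refine ⟨i.inv ≫ f, fun h => ?_, fun g hg => ?_⟩
    · rw [hi', Category.assoc, Category.assoc, Iso.hom_inv_id_assoc, hf, Iso.inv_hom_id_assoc]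
    · rw [Iso.eq_inv_comp]
      refine hu _ fun h => ?_
      rw [← Category.assoc, hi, Category.assoc, hg]

theorem LimCond.Holds.of_iso {V : Type} [Quiver.{0} V] {F G : V ⥤q C}
    (θ : ∀ a, F.obj a ≅ G.obj a)
    (hθ : ∀ {a b : V} (e : a ⟶ b), F.map e ≫ (θ b).hom = (θ a).hom ≫ G.map e)
    {c : LimCond V} (hc : c.Holds F) : c.Holds G := by
  obtain ⟨K⟩ := c
  exact IsGraphLimit.of_iso hc (fun h => θ (K.diagram.obj h)) (fun e => hθ (K.diagram.map e))
    (θ K.pt) (fun h => hθ (K.leg h))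

theorem ColimCond.Holds.of_iso {V : Type} [Quiver.{0} V] {F G : V ⥤q C}
    (θ : ∀ a, F.obj a ≅ G.obj a)
    (hθ : ∀ {a b : V} (e : a ⟶ b), F.map e ≫ (θ b).hom = (θ a).hom ≫ G.map e)
    {c : ColimCond V} (hc : c.Holds F) : c.Holds G := by
  obtain ⟨K⟩ := c
  exact IsGraphColimit.of_iso hc (fun h => θ (K.diagram.obj h)) (fun e => hθ (K.diagram.map e))
    (θ K.pt) (fun h => hθ (K.leg h))

/-- A morphism of graphs that is isomorphic to a structure is a structure. -/
def Model.ofIso {X : Sketch} (M : Model C X) (G : X.V ⥤q C) (θ : ∀ a, M.obj a ≅ G.obj a)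
    (hθ : ∀ {a b : X.V} (e : a ⟶ b), M.map e ≫ (θ b).hom = (θ a).hom ≫ G.map e) :
    Model C X where
  toPrefunctor := G
  comm_holds c hc := (M.comm_holds c hc).of_iso θ hθ
  lim_holds c hc := (M.lim_holds c hc).of_iso θ hθ
  colim_holds c hc := (M.colim_holds c hc).of_iso θ hθ

/-- Isomorphisms of structures from isomorphisms on vertices. -/
def Model.isoMk {X : Sketch} {M N : Model C X} (θ : ∀ a, M.obj a ≅ N.obj a)
    (hθ : ∀ {a b : X.V} (e : a ⟶ b), M.map e ≫ (θ b).hom = (θ a).hom ≫ N.map e) : M ≅ N where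
  hom := ⟨fun a => (θ a).hom, hθ⟩
  inv := ⟨fun a => (θ a).inv, fun e => by
    rw [Iso.comp_inv_eq, Category.assoc, hθ, Iso.inv_hom_id_assoc]⟩
  hom_inv_id := Model.Hom.ext (funext fun a => (θ a).hom_inv_id)
  inv_hom_id := Model.Hom.ext (funext fun a => (θ a).inv_hom_id)

/-- The component of an isomorphism of structures at a vertex. -/
def Model.isoApp {X : Sketch} {M N : Model C X} (i : M ≅ N) (a : X.V) : M.obj a ≅ N.obj a where
  hom := i.hom.app a
  inv := i.inv.app a
  hom_inv_id := congrArg (fun m : Model.Hom M M => m.app a) i.hom_inv_id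
  inv_hom_id := congrArg (fun m : Model.Hom N N => m.app a) i.inv_hom_id

theorem prefunctor_ext {V : Type} [Quiver.{0} V] {F G : V ⥤q C} (h : ∀ a, F.obj a = G.obj a)
    (hm : ∀ {a b : V} (e : a ⟶ b), F.map e ≫ eqToHom (h b) = eqToHom (h a) ≫ G.map e) :
    F = G := by
  obtain ⟨o, m⟩ := F
  obtain ⟨o', m'⟩ := G
  obtain rfl : o = o' := funext h
  congr 1
  funext a b e
  simpa using hm e

theorem Model.ext' {X : Sketch} {M N : Model C X} (h : M.toPrefunctor = N.toPrefunctor) :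
    M = N := by
  cases M
  cases N
  congr

theorem Model.eqToHom_app {X : Sketch} {M N : Model C X} (h : M = N) (a : X.V) :
    Model.Hom.app (eqToHom h) a = eqToHom (congrArg (fun M : Model C X => M.obj a) h) := by
  subst h
  rfl

/-- A functor is an isofibration: isomorphisms in the codomain lift along the functor. -/
def IsIsofibration {M : Type*} [Category* M] {N : Type*} [Category* N] (p : M ⥤ N) : Prop :=
  ∀ (m : M) (n : N) (i : p.obj m ≅ n), ∃ (m' : M) (j : m ≅ m') (e : p.obj m' = n),
    p.map j.hom = i.hom ≫ eqToHom e.symm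

/-- Replace the object at `φ x` by the prescribed one, keep the other objects, and conjugate all
arrows. Injectivity on vertices makes the replacement unambiguous. -/
theorem isIsofibration_restrict {X A : Sketch} (φ : X.Hom A) (hφ : Function.Injective φ.obj) :
    IsIsofibration (restrict C φ) := by
  intro M N i
  let r : ∀ x, M.obj (φ.obj x) ≅ N.obj x := fun x => Model.isoApp i x
  have hr : ∀ {a b : X.V} (e : a ⟶ b), M.map (φ.map e) ≫ (r b).hom = (r a).hom ≫ N.map e :=
    fun e => i.hom.naturality e
  -- The new object and the comparison isomorphism are chosen together, so that the equality with
  -- `N.obj x` and the formula for `t` refer to the same choice.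
  have key : ∀ a : A.V, ∃ (o : C) (t : M.obj a ≅ o), ∀ (x : X.V) (hx : φ.obj x = a),
      ∃ h : o = N.obj x, t.hom = eqToHom (by rw [hx]) ≫ (r x).hom ≫ eqToHom h.symm := by
    intro a
    by_cases h : ∃ x, φ.obj x = a
    · obtain ⟨x, rfl⟩ := h
      refine ⟨N.obj x, r x, fun x' hx' => ?_⟩
      obtain rfl := hφ hx'
      exact ⟨rfl, by simp⟩
    · exact ⟨M.obj a, Iso.refl _, fun x hx => (h ⟨x, hx⟩).elim⟩
  choose o t ht using key
  have ho : ∀ x, o (φ.obj x) = N.obj x := fun x => (ht _ x rfl).1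
  have ht' : ∀ x, (t (φ.obj x)).hom = (r x).hom ≫ eqToHom (ho x).symm := fun x => by
    obtain ⟨h, e⟩ := ht _ x rfl
    exact e.trans (Category.id_comp _)
  have ht'' : ∀ x, (t (φ.obj x)).hom ≫ eqToHom (ho x) = (r x).hom := fun x => by
    rw [ht', Category.assoc, eqToHom_trans, eqToHom_refl, Category.comp_id]
  let M' := M.ofIso ⟨o, fun {a b} e => (t a).inv ≫ M.map e ≫ (t b).hom⟩ t (fun e => by simp)
  have e : (restrict C φ).obj M' = N := by
    refine Model.ext' (prefunctor_ext ho fun {a b} e => ?_)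
    have h : ((t (φ.obj a)).inv ≫ M.map (φ.map e) ≫ (t (φ.obj b)).hom) ≫ eqToHom (ho b) =
        eqToHom (ho a) ≫ N.map e := by
      rw [Category.assoc, Category.assoc, ht'', hr, ← ht'' a, Category.assoc,
        Iso.inv_hom_id_assoc]
    exact h
  refine ⟨M', Model.isoMk t (fun e => by simp [M', Model.ofIso]), e, ?_⟩
  refine Model.Hom.ext (funext fun x => ?_)
  exact (ht' x).trans (congrArg (fun m => (r x).hom ≫ m) (Model.eqToHom_app e.symm x).symm)

/-- Functors which factor through an isofibration up to isomorphism factor through it strictly. -/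
theorem IsIsofibration.exists_comp_eq {E : Type*} [Category* E] {M : Type*} [Category* M]
    {N : Type*} [Category* N] {p : M ⥤ N} (hp : IsIsofibration p) {Q : E ⥤ M} {R : E ⥤ N}
    (θ : Q ⋙ p ≅ R) : ∃ Q' : E ⥤ M, Q' ⋙ p = R := by
  choose o j e h using fun x => hp (Q.obj x) (R.obj x) (θ.app x)
  have h' : ∀ x, p.map (j x).inv = eqToHom (e x) ≫ θ.inv.app x := fun x => by
    rw [← cancel_epi (p.map (j x).hom), ← p.map_comp, Iso.hom_inv_id, p.map_id, h]
    simp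
  -- The functor `Q` conjugated by the lifted isomorphisms.
  let Q' : E ⥤ M :=
    { obj := o
      map := fun {x x'} m => (j x).inv ≫ Q.map m ≫ (j x').hom }
  refine ⟨Q', CategoryTheory.Functor.ext e fun x x' m => ?_⟩
  change p.map ((j x).inv ≫ Q.map m ≫ (j x').hom) = _
  have n : p.map (Q.map m) ≫ θ.hom.app x' = θ.hom.app x ≫ R.map m := θ.hom.naturality m
  simp [h, h', reassoc_of% n]

end Transport

/-! ### Structures of the underlying sketch of a category as functors -/

section UnderlyingSketch

variable {X A : Sketch} {D : Type u} [Category.{v} D]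

/-- The category with underlying graph `V`. -/
def CategoryOn.Cat {V : Type} [Quiver.{0} V] (_ : CategoryOn V) : Type := V

instance {V : Type} [Quiver.{0} V] (K : CategoryOn V) : Category.{0} K.Cat := K.toCategory

variable (D) in
/-- The structures of a sketch whose conditions include those of the underlying sketch of a category
are functors. -/
def modelFunctor (K : CategoryOn A.V) (hK : ∀ c, K.IsUnderlyingCond c → c ∈ A.comm) :
    Model D A ⥤ (K.Cat ⥤ D) where
  obj M :=
    { obj := M.obj
      map := fun f => M.map f
      map_id := fun a => by
        have h := M.comm_holds _ (hK _ (.id a))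
        exact (Category.id_comp _).symm.trans h
      map_comp := fun {a b c} f g => by
        have h := M.comm_holds _ (hK _ (.comp f g))
        refine (Category.id_comp _).symm.trans (h.symm.trans ?_)
        exact congrArg (fun m => m ≫ M.map g) (Category.id_comp (M.map f)) }
  map m :=
    { app := m.app
      naturality := fun _ _ f => m.naturality f }

theorem CommCond.holds_map {V W : Type} [Quiver.{0} V] [Quiver.{0} W] (φ : V ⥤q W) (G : W ⥤q D)
    (c : CommCond V) : (c.map φ).Holds G ↔ c.Holds (φ ⋙q G) := by
  unfold CommCond.Holds
  rw [Prefunctor.mapPath_comp_apply, Prefunctor.mapPath_comp_apply]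
  rfl

theorem LimCond.holds_map {V W : Type} [Quiver.{0} V] [Quiver.{0} W] (φ : V ⥤q W) (G : W ⥤q D)
    (c : LimCond V) : (c.map φ).Holds G ↔ c.Holds (φ ⋙q G) := by
  obtain ⟨K⟩ := c
  rfl

theorem ColimCond.holds_map {V W : Type} [Quiver.{0} V] [Quiver.{0} W] (φ : V ⥤q W) (G : W ⥤q D)
    (c : ColimCond V) : (c.map φ).Holds G ↔ c.Holds (φ ⋙q G) := by
  obtain ⟨K⟩ := c
  rfl

/-- For `α : X ⟶ A` unconditional of finite kind, every functor which restricts to an `X`-structure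
up to isomorphism is an `A`-structure. -/
def Model.ofFunctor (α : X.Hom A) (K : CategoryOn A.V)
    (hcomm : A.comm = {c | K.IsUnderlyingCond c} ∪ CommCond.map α.toPrefunctor '' X.comm)
    (hlim : A.lim = LimCond.map α.toPrefunctor '' X.lim)
    (hcolim : A.colim = ColimCond.map α.toPrefunctor '' X.colim)
    (T : K.Cat ⥤ D) (F : Model D X) (θ : ∀ x, F.obj x ≅ T.obj (α.obj x))
    (hθ : ∀ {a b : X.V} (e : a ⟶ b),
      F.map e ≫ (θ b).hom = (θ a).hom ≫ T.map (α.map e)) : Model D A :=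
  let T' : A.V ⥤q D := ⟨T.obj, fun {a b} f => T.map (X := a) (Y := b) f⟩
  { toPrefunctor := T'
    comm_holds := by
      rw [hcomm]
      rintro _ ((⟨f, g⟩ | a) | ⟨c, hc, rfl⟩)
      · refine Eq.trans ?_ (Category.id_comp _).symm
        refine (congrArg (fun m => m ≫ T'.map g) (Category.id_comp (T'.map f))).trans ?_
        exact (T.map_comp f g).symm
      · exact (Category.id_comp _).trans (T.map_id _)
      · exact (CommCond.holds_map _ _ _).2 ((F.comm_holds c hc).of_iso θ hθ)
    lim_holds := by
      rw [hlim]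
      rintro _ ⟨c, hc, rfl⟩
      exact (LimCond.holds_map _ _ _).2 ((F.lim_holds c hc).of_iso θ hθ)
    colim_holds := by
      rw [hcolim]
      rintro _ ⟨c, hc, rfl⟩
      exact (ColimCond.holds_map _ _ _).2 ((F.colim_holds c hc).of_iso θ hθ) }

end UnderlyingSketch

/-! ### The Yoneda embedding on structures -/

section YonedaFiber

open Functor

/-- Objects of a fibre lie over `S` only up to a propositional equality, so "restricting to the
identity" has to be expressed by `eqToHom`. -/
theorem isHomLift_id_iff {M N : Type*} [Category* M] [Category* N] {p : M ⥤ N} {S : N} {a b : M}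
    (ha : p.obj a = S) (hb : p.obj b = S) (φ : a ⟶ b) :
    IsHomLift p (𝟙 S) φ ↔ p.map φ = eqToHom (ha.trans hb.symm) := by
  constructor
  · intro h
    rw [IsHomLift.fac' p (𝟙 S) φ]
    simp
  · intro h
    exact IsHomLift.of_fac' p _ φ ha hb (by rw [h]; simp)

variable {X A : Sketch} {D : Type u} [Category.{v} D]

theorem fiber_obj (α : X.Hom A) {F : Model D X} (G : (restrict D α).Fiber F) (x : X.V) :
    G.1.obj (α.obj x) = F.obj x :=
  congrArg (fun M : Model D X => M.obj x) G.2

theorem Model.map_eqToHom {M N : Model D X} (h : M = N) {a b : X.V} (e : a ⟶ b) :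
    M.map e ≫ eqToHom (congrArg (fun M : Model D X => M.obj b) h) =
      eqToHom (congrArg (fun M : Model D X => M.obj a) h) ≫ N.map e := by
  subst h
  exact (Category.comp_id _).trans (Category.id_comp _).symm

theorem fiber_map (α : X.Hom A) {F : Model D X} (G : (restrict D α).Fiber F) {a b : X.V}
    (e : a ⟶ b) : G.1.map (α.map e) ≫ eqToHom (fiber_obj α G b) =
      eqToHom (fiber_obj α G a) ≫ F.map e :=
  Model.map_eqToHom G.2 e

theorem fiber_app (α : X.Hom A) {F : Model D X} {G G' : (restrict D α).Fiber F} (m : G ⟶ G')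
    (x : X.V) : m.1.app (α.obj x) = eqToHom ((fiber_obj α G x).trans (fiber_obj α G' x).symm) := by
  have h := (isHomLift_id_iff G.2 G'.2 m.1).1 m.2
  exact (congrArg (fun n : Model.Hom _ _ => n.app x) h).trans (Model.eqToHom_app _ x)

theorem isHomLift_of_app (α : X.Hom A) {F : Model D X} {G G' : (restrict D α).Fiber F}
    (m : G.1 ⟶ G'.1)
    (h : ∀ x, m.app (α.obj x) = eqToHom ((fiber_obj α G x).trans (fiber_obj α G' x).symm)) :
    IsHomLift (restrict D α) (𝟙 F) m :=
  (isHomLift_id_iff G.2 G'.2 m).2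
    (Model.Hom.ext (funext fun x => (h x).trans (Model.eqToHom_app (G.2.trans G'.2.symm) x).symm))

variable (D) in
/-- Evaluation of structures at a vertex. -/
def modelEval {X : Sketch} (a : X.V) : Model D X ⥤ D where
  obj M := M.obj a
  map m := m.app a

variable (D) in
/-- Arrows of a sketch act on evaluations. -/
def modelEvalMap {X : Sketch} {a b : X.V} (e : a ⟶ b) : modelEval D a ⟶ modelEval D b where
  app M := M.map e
  naturality _ _ m := (m.naturality e).symm

/-- Evaluation of the structures in a fibre at a vertex. -/
def fiberEval (α : X.Hom A) (F : Model D X) (a : A.V) : (restrict D α).Fiber F ⥤ D :=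
  Fiber.fiberInclusion (p := restrict D α) ⋙ modelEval D a

/-- The functor `F ↦ yF` on structures. -/
def modelYoneda (C : Type u) [SmallCategory C] (X : Sketch) :
    Model C X ⥤ Model (ProCompletion C) X where
  obj F := F.yoneda
  map m :=
    { app := fun a => (y C).map (m.app a)
      naturality := fun e => ((y C).map_comp _ _).symm.trans
        ((congrArg (y C).map (m.naturality e)).trans ((y C).map_comp _ _)) }
  map_id _ := Model.Hom.ext (funext fun _ => (y C).map_id _)
  map_comp _ _ := Model.Hom.ext (funext fun _ => (y C).map_comp _ _)

/-- The functor `G ↦ yG` on fibres. -/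
def fiberYoneda {C : Type u} [SmallCategory C] (α : X.Hom A) (F : Model C X) :
    (restrict C α).Fiber F ⥤ (restrict (ProCompletion C) α).Fiber F.yoneda :=
  Fiber.inducedFunctor (p := restrict (ProCompletion C) α) (S := F.yoneda)
    (F := Fiber.fiberInclusion (p := restrict C α) ⋙ modelYoneda C A) (by
      -- Restriction along `α` and composition with `y` commute by definition.
      change (Fiber.fiberInclusion (p := restrict C α) ⋙ restrict C α) ⋙ modelYoneda C X = _
      rw [Fiber.fiberInclusion_comp_eq_const]
      refine CategoryTheory.Functor.ext (fun _ => rfl) fun _ _ _ => ?_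
      exact ((modelYoneda C X).map_id F).trans
        ((Category.id_comp _).trans (Category.id_comp _)).symm)

end YonedaFiber

/-! ### Structures in the pro-completion as limits of structures -/

section FiberApproximation

variable {X A : Sketch} {C : Type u} [SmallCategory C]
  {α : X.Hom A} {F : Model C X} (K : CategoryOn A.V)
  (hK : ∀ c, K.IsUnderlyingCond c → c ∈ A.comm)
  (G : (restrict (ProCompletion C) α).Fiber F.yoneda)

/-- The approximations of a structure by structures in the fibre are approximations of the
corresponding functor. -/
def toApprox : StructuredArrow G (fiberYoneda α F) ⥤
    Approx (y C) ((modelFunctor (ProCompletion C) K hK).obj G.1) where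
  obj i := StructuredArrow.mk (Y := (modelFunctor C K hK).obj i.right.1)
    ((modelFunctor (ProCompletion C) K hK).map i.hom.1)
  map {i j} f := StructuredArrow.homMk ((modelFunctor C K hK).map f.right.1) (by
    have h := congrArg (fun m => (modelFunctor (ProCompletion C) K hK).map m.1)
      (StructuredArrow.w f)
    exact h)

theorem eq_eqToHom_of_y {P : ProCompletion C} {c d : C} (m : c ⟶ d) (h₁ : P = (y C).obj c)
    (h₂ : P = (y C).obj d) (e : c = d) (h : eqToHom h₁ ≫ (y C).map m = eqToHom h₂) :
    m = eqToHom e := by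
  subst h₁ e
  apply (y C).map_injective
  exact (Category.id_comp _).symm.trans (h.trans ((y C).map_id c).symm)

instance : (toApprox K hK G).Faithful where
  map_injective {i j} f g h := by
    refine StructuredArrow.hom_ext _ _ (Subtype.ext (Model.Hom.ext ?_))
    exact congrArg (fun m => m.right.app) h

/-- Over `X` the maps out of `G` are identities up to `eqToHom`. Compatibility with them, together
with faithfulness of `y`, forces a transformation to be the identity over `F`, so it lies in the
fibre. -/
instance : (toApprox K hK G).Full where
  map_surjective {i j} f := by
    let m : i.right.1 ⟶ j.right.1 := ⟨f.right.app, fun e => f.right.naturality e⟩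
    have hm : ∀ a, i.hom.1.app a ≫ (y C).map (m.app a) = j.hom.1.app a := fun a =>
      congrArg (fun n => n.app a) (StructuredArrow.w f)
    have hm' : ∀ x, m.app (α.obj x) =
        eqToHom ((fiber_obj α i.right x).trans (fiber_obj α j.right x).symm) := fun x => by
      have h := hm (α.obj x)
      rw [fiber_app, fiber_app] at h
      exact eq_eqToHom_of_y _ _ _ _ h
    have := isHomLift_of_app α m hm'
    refine ⟨StructuredArrow.homMk ⟨m, this⟩ (Subtype.ext (Model.Hom.ext (funext hm))), ?_⟩
    refine StructuredArrow.hom_ext _ _ ?_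
    rfl

/-- Isomorphisms between morphisms of graphs descend along the Yoneda embedding. -/
theorem exists_iso_of_y {V : Type} [Quiver.{0} V] {f t : V ⥤q C} {g : V ⥤q ProCompletion C}
    (h : ∀ a, g.obj a = (y C).obj (f.obj a))
    (hm : ∀ {a b : V} (e : a ⟶ b), g.map e ≫ eqToHom (h b) = eqToHom (h a) ≫ (y C).map (f.map e))
    (η : ∀ a, g.obj a ⟶ (y C).obj (t.obj a))
    (hη : ∀ {a b : V} (e : a ⟶ b), g.map e ≫ η b = η a ≫ (y C).map (t.map e))
    (hi : ∀ a, IsIso (η a)) :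
    ∃ θ : ∀ a, f.obj a ≅ t.obj a, (∀ {a b : V} (e : a ⟶ b),
      f.map e ≫ (θ b).hom = (θ a).hom ≫ t.map e) ∧
        ∀ a, η a = eqToHom (h a) ≫ (y C).map (θ a).hom := by
  let θ : ∀ a, f.obj a ≅ t.obj a := fun a =>
    (y C).preimageIso (eqToIso (h a).symm ≪≫ asIso (η a))
  have hθ : ∀ a, (y C).map (θ a).hom = eqToHom (h a).symm ≫ η a := fun a =>
    (y C).map_preimage _
  have hθ' : ∀ a, η a = eqToHom (h a) ≫ (y C).map (θ a).hom := fun a => by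
    rw [hθ, eqToHom_trans_assoc, eqToHom_refl, Category.id_comp]
  refine ⟨θ, fun {a b} e => ?_, hθ'⟩
  apply (y C).map_injective
  rw [Functor.map_comp, Functor.map_comp, ← cancel_epi (eqToHom (h a)), ← Category.assoc, ← hm,
    Category.assoc, ← hθ', hη, hθ', Category.assoc]

theorem eqToHom_comp_y_map {P : ProCompletion C} {c d m : C} (h : P = (y C).obj c) (t : c ≅ m)
    (e : c = d) : (eqToHom h ≫ (y C).map t.hom) ≫ (y C).map (t.inv ≫ eqToHom e) =
      eqToHom (h.trans (congrArg (y C).obj e)) := by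
  subst h e
  rw [Category.assoc, ← Functor.map_comp]
  simp

/-- A transformation from a structure `G` over `yF` to `yM` that is invertible over `F` makes `M`
isomorphic to a structure over `F`. -/
theorem exists_fiber_hom (hα : Function.Injective α.obj) (M : Model C A)
    (η : G.1 ⟶ M.yoneda) (θ : ∀ x, F.obj x ≅ M.obj (α.obj x))
    (hθ : ∀ {a b : X.V} (e : a ⟶ b), F.map e ≫ (θ b).hom = (θ a).hom ≫ M.map (α.map e))
    (hη : ∀ x, η.app (α.obj x) = eqToHom (fiber_obj α G x) ≫ (y C).map (θ x).hom) :
    ∃ (H : (restrict C α).Fiber F) (η' : G ⟶ (fiberYoneda α F).obj H) (j : H.1 ⟶ M),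
      η'.1 ≫ (modelYoneda C A).map j = η := by
  obtain ⟨H, j, e, hj⟩ := isIsofibration_restrict α hα M F
    (Model.isoMk (M := F) (N := (restrict C α).obj M) θ hθ).symm
  let H' : (restrict C α).Fiber F := ⟨H, e⟩
  let η' : G.1 ⟶ ((fiberYoneda α F).obj H').1 := η ≫ (modelYoneda C A).map j.hom
  have hj' : ∀ x, j.hom.app (α.obj x) =
      (θ x).inv ≫ eqToHom (congrArg (fun M : Model C X => M.obj x) e.symm) := fun x =>
    (congrArg (fun m : Model.Hom _ _ => m.app x) hj).trans
      (congrArg (fun m => (θ x).inv ≫ m) (Model.eqToHom_app e.symm x))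
  have := isHomLift_of_app α (G := G) (G' := (fiberYoneda α F).obj H') η' (fun x => by
    have h : η.app (α.obj x) ≫ (y C).map (j.hom.app (α.obj x)) =
        eqToHom ((fiber_obj α G x).trans
          (congrArg (fun M : Model C X => (y C).obj (M.obj x)) e.symm)) := by
      rw [hη, hj']
      exact eqToHom_comp_y_map _ _ _
    exact h)
  refine ⟨H', ⟨η', this⟩, j.inv, ?_⟩
  change (η ≫ (modelYoneda C A).map j.hom) ≫ (modelYoneda C A).map j.inv = η
  exact (Category.assoc _ _ _).trans
    ((congrArg (fun m => η ≫ m) ((modelYoneda C A).mapIso j).hom_inv_id).trans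
      (Category.comp_id _))

variable [HasFiniteLimits C]
  (hcomm : A.comm = {c | K.IsUnderlyingCond c} ∪ CommCond.map α.toPrefunctor '' X.comm)
  (hlim : A.lim = LimCond.map α.toPrefunctor '' X.lim)
  (hcolim : A.colim = ColimCond.map α.toPrefunctor '' X.colim)
  (hα : Function.Injective α.obj)

include hcomm hlim hcolim hα

/-- Cofinality of the fibre approximations. Refine `T` until it is invertible at the finitely many
vertices of `X`. Its restriction to `X` is then isomorphic to `F`, so unconditionality of `α` makes
it an `A`-structure, which is moved into the fibre along the isomorphism. -/
theorem exists_toApprox_hom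
    (T : Approx (y C) ((modelFunctor (ProCompletion C) K hK).obj G.1)) :
    ∃ i, Nonempty ((toApprox K hK G).obj i ⟶ T) := by
  have : ∀ a b : K.Cat, Finite (a ⟶ b) := fun a b => A.finite_arr a b
  obtain ⟨T, j, hT⟩ := T.exists_isIso_of_finite (s := Set.range (fun x => (α.obj x : K.Cat)))
    (Set.finite_range _) (by
      rintro _ ⟨x, rfl⟩
      exact ⟨F.obj x, ⟨eqToIso (fiber_obj α G x)⟩⟩)
  suffices h : ∃ i, Nonempty ((toApprox K hK G).obj i ⟶ T) by
    obtain ⟨i, ⟨f⟩⟩ := h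
    exact ⟨i, ⟨f ≫ j⟩⟩
  let t : A.V ⥤q C := ⟨T.right.obj, fun {a b} f => T.right.map (X := a) (Y := b) f⟩
  obtain ⟨θ, hθ, hθ'⟩ := exists_iso_of_y (f := F.toPrefunctor)
    (t := α.toPrefunctor ⋙q t) (g := α.toPrefunctor ⋙q G.1.toPrefunctor)
    (fiber_obj α G) (fiber_map α G) (fun x => T.hom.app (α.obj x))
    (fun e => T.hom.naturality (α.map e)) (fun x => hT _ ⟨x, rfl⟩)
  let M : Model C A := Model.ofFunctor α K hcomm hlim hcolim T.right F θ hθ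
  obtain ⟨H, η', k, hk⟩ := exists_fiber_hom G hα M
    ⟨fun a => T.hom.app a, fun f => T.hom.naturality f⟩ θ hθ hθ'
  refine ⟨StructuredArrow.mk η', ⟨StructuredArrow.homMk
    { app := fun a => k.app a, naturality := fun a b f => k.naturality f } ?_⟩⟩
  exact NatTrans.ext (funext fun a => congrArg (fun m : Model.Hom _ _ => m.app a) hk)

/-- Cofilteredness of `Approx` is inherited along the fully faithful functor `toApprox`, by the
cofinality just shown. -/
theorem isCofiltered_structuredArrow_fiberYoneda :
    IsCofiltered (StructuredArrow G (fiberYoneda α F)) :=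
  have hK : ∀ c, K.IsUnderlyingCond c → c ∈ A.comm := fun c hc => by
    rw [hcomm]
    exact Or.inl hc
  .of_exists_of_isCofiltered_of_fullyFaithful (toApprox K hK G)
    (exists_toApprox_hom K hK G hcomm hlim hcolim hα)

/-- A structure in the pro-completion is the limit of its approximations, at every vertex. -/
theorem isProLimit_fiberApproximation (a : A.V) :
    IsProLimit (W := StructuredArrow.proj G (fiberYoneda α F) ⋙ fiberEval α F a)
      { pt := G.1.obj a
        π := { app := fun i => i.hom.1.app a
               naturality := fun i j f => by
                have h := congrArg (fun m => m.1.app a) (StructuredArrow.w f)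
                exact (Category.id_comp _).trans h.symm } } := by
  have hK : ∀ c, K.IsUnderlyingCond c → c ∈ A.comm := fun c hc => by
    rw [hcomm]
    exact Or.inl hc
  have : ∀ a b : K.Cat, Finite (a ⟶ b) := fun a b => A.finite_arr a b
  have key := exists_toApprox_hom K hK G hcomm hlim hcolim hα
  constructor
  · intro d p
    obtain ⟨T, h, hT⟩ := Approx.exists_fac (Y := y C)
      (G := (modelFunctor (ProCompletion C) K hK).obj G.1) (a := a) p
    obtain ⟨i, ⟨j⟩⟩ := key T
    have hj : i.hom.1.app a ≫ (y C).map (j.right.app a) = T.hom.app a :=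
      congrArg (fun n => n.app a) (StructuredArrow.w j)
    refine ⟨i, j.right.app a ≫ h, ?_⟩
    refine (congrArg (fun m => i.hom.1.app a ≫ m) ((y C).map_comp _ _)).trans ?_
    exact (Category.assoc _ _ _).symm.trans ((congrArg (fun m => m ≫ (y C).map h) hj).trans hT)
  · intro i d h₁ h₂ h
    obtain ⟨T, j, -, hj⟩ :=
      Approx.exists_mono_eq (A := K.Cat) (a := a) ((toApprox K hK G).obj i) h₁ h₂ h
    obtain ⟨i', ⟨j'⟩⟩ := key T
    -- Fullness turns the refinement among functors into a refinement within the fibre.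
    obtain ⟨f, hf⟩ := (toApprox K hK G).map_surjective (j' ≫ j)
    refine ⟨i', f, ?_⟩
    have e : f.right.1.app a = j'.right.app a ≫ j.right.app a :=
      congrArg (fun n => n.right.app a) hf
    refine (congrArg (fun m => m ≫ h₁) e).trans
      (Eq.trans ?_ (congrArg (fun m => m ≫ h₂) e).symm)
    exact (Category.assoc _ _ _).trans ((congrArg _ hj).trans (Category.assoc _ _ _).symm)

end FiberApproximation

/-! ### Cofiltered limits of structures in the pro-completion -/

section LimitModel

/-- A functor to structures as a morphism of graphs to functors. -/
def transpose {X : Sketch} {D : Type u} [Category.{v} D] {E : Type u'} [Category.{v'} E]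
    (Q : E ⥤ Model D X) : X.V ⥤q (E ⥤ D) where
  obj a := Q ⋙ modelEval D a
  map e := Functor.whiskerLeft Q (modelEvalMap D e)

/-- The vertexwise limit of a cofiltered diagram of structures. -/
noncomputable def limitModel {X : Sketch} {C : Type u} [SmallCategory C] [HasFiniteLimits C]
    {J : Type u} [SmallCategory J] [IsCofiltered J] (Q : J ⥤ Model C X) :
    Model (ProCompletion C) X where
  toPrefunctor := transpose Q ⋙q (proLim C J).toPrefunctor
  comm_holds c hc := by
    unfold CommCond.Holds
    rw [composePath_mapPath_comp, composePath_mapPath_comp]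
    congr 1
    refine NatTrans.ext (funext fun j => ?_)
    have h := (Q.obj j).comm_holds c hc
    refine (composePath_mapPath_comp (transpose Q) ((evaluation J C).obj j) c.lhs).symm.trans
      (Eq.trans h ?_)
    exact composePath_mapPath_comp (transpose Q) ((evaluation J C).obj j) c.rhs
  lim_holds := by
    rintro ⟨K⟩ hK
    exact isGraphLimit_proLim (D := K.diagram ⋙q transpose Q)
      (fun j => (Q.obj j).lim_holds _ hK)
  colim_holds := by
    rintro ⟨K⟩ hK
    exact isGraphColimit_proLim (D := K.diagram ⋙q transpose Q)
      (fun j => (Q.obj j).colim_holds _ hK)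

end LimitModel

/-! ### Right Kan extension of functors with values in structures -/

section Extension

open Functor

variable {E : Type u} [Category.{u} E] {E' : Type u'} [Category.{u} E'] {C : Type u}
  [SmallCategory C] (L : E ⥤ E') [∀ G, IsCofiltered (StructuredArrow G L)]

instance (W : E ⥤ ProCompletion C) : HasPointwiseRightKanExtension L W := fun G =>
  inferInstanceAs (HasLimit (StructuredArrow.proj G L ⋙ W))

/-- The right Kan extension along `L` of the functor `yW`. -/
noncomputable def proRan : (E ⥤ C) ⥤ (E' ⥤ ProCompletion C) :=
  (whiskeringRight E C (ProCompletion C)).obj (y C) ⋙ L.ran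

/-- The values of the right Kan extension are limits. -/
noncomputable def proRanObjIso (W : E ⥤ C) (G : E') :
    (proLim C (StructuredArrow G L)).obj (StructuredArrow.proj G L ⋙ W) ≅
      ((proRan L).obj W).obj G :=
  (L.ranObjObjIsoLimit (W ⋙ y C) G).symm

/-- Lets the arrows of a sketch be transported from the vertexwise limit to the Kan extension, as
`extendModelObj` requires; it is checked on the limit projections. -/
theorem proRanObjIso_naturality {V W : E ⥤ C} (m : V ⟶ W) (G : E') :
    (proLim C (StructuredArrow G L)).map (whiskerLeft (StructuredArrow.proj G L) m) ≫
      (proRanObjIso L W G).hom = (proRanObjIso L V G).hom ≫ ((proRan L).map m).app G := by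
  let m' := whiskerRight m (y C)
  have key : (L.ranObjObjIsoLimit (V ⋙ y C) G).hom ≫
      limMap (whiskerLeft (StructuredArrow.proj G L) m') =
        (L.ran.map m').app G ≫ (L.ranObjObjIsoLimit (W ⋙ y C) G).hom := by
    refine limit.hom_ext fun f => ?_
    have n₁ : (L.ran.map m').app (L.obj f.right) ≫ (L.ranCounit.app (W ⋙ y C)).app f.right =
        (L.ranCounit.app (V ⋙ y C)).app f.right ≫ m'.app f.right :=
      congrArg (fun t => t.app f.right) (L.ranCounit.naturality m')
    have n₂ := (L.ran.map m').naturality f.hom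
    rw [Category.assoc, Category.assoc, limMap_π, ranObjObjIsoLimit_hom_π,
      ranObjObjIsoLimit_hom_π_assoc]
    exact (congrArg (fun t => (L.ran.obj (V ⋙ y C)).map f.hom ≫ t) n₁).symm.trans
      ((Category.assoc _ _ _).symm.trans
        ((congrArg (fun t => t ≫ (L.ranCounit.app (W ⋙ y C)).app f.right) n₂).trans
          (Category.assoc _ _ _)))
  have key' : limMap (whiskerLeft (StructuredArrow.proj G L) m') ≫
      (L.ranObjObjIsoLimit (W ⋙ y C) G).inv =
        (L.ranObjObjIsoLimit (V ⋙ y C) G).inv ≫ (L.ran.map m').app G := by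
    rw [Iso.comp_inv_eq, Category.assoc, ← key, Iso.inv_hom_id_assoc]
  exact key'

/-- Extension along `L` of a functor to the structures in `C`, at an object. -/
noncomputable def extendModelObj [HasFiniteLimits C] {X : Sketch} (Q : E ⥤ Model C X) (G : E') :
    Model (ProCompletion C) X :=
  Model.ofIso (limitModel (StructuredArrow.proj G L ⋙ Q))
    { obj := fun a => ((proRan L).obj (Q ⋙ modelEval C a)).obj G
      map := fun e => ((proRan L).map (whiskerLeft Q (modelEvalMap C e))).app G }
    (fun a => proRanObjIso L (Q ⋙ modelEval C a) G)
    (fun e => proRanObjIso_naturality L (whiskerLeft Q (modelEvalMap C e)) G)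

/-- Extension along `L` of a functor to the structures in `C`. -/
noncomputable def extendModel [HasFiniteLimits C] {X : Sketch} (Q : E ⥤ Model C X) :
    E' ⥤ Model (ProCompletion C) X where
  obj G := extendModelObj L Q G
  map m :=
    { app := fun a => ((proRan L).obj (Q ⋙ modelEval C a)).map m
      naturality := fun e =>
        (((proRan L).map (whiskerLeft Q (modelEvalMap C e))).naturality m).symm }
  map_id G := Model.Hom.ext (funext fun a => ((proRan L).obj (Q ⋙ modelEval C a)).map_id G)
  map_comp m n := Model.Hom.ext (funext fun a =>
    ((proRan L).obj (Q ⋙ modelEval C a)).map_comp m n)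

end Extension

/-! ### Evaluations as Kan extensions and the restriction of the extended functor -/

section Verification

open Functor

variable {X A B : Sketch} {C : Type u} [SmallCategory C] {α : X.Hom A} {F : Model C X}

/-- Evaluation on the fibre over `yF` is a right Kan extension. -/
theorem isIso_unit_fiberEval [∀ G, IsCofiltered (StructuredArrow G (fiberYoneda α F))]
    (a : A.V) (h : ∀ G, IsProLimit
      (W := StructuredArrow.proj G (fiberYoneda α F) ⋙ fiberEval α F a)
      { pt := G.1.obj a
        π := { app := fun i => i.hom.1.app a
               naturality := fun i j f => by
                have h := congrArg (fun m => m.1.app a) (StructuredArrow.w f)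
                exact (Category.id_comp _).trans h.symm } }) :
    IsIso (((fiberYoneda α F).ranAdjunction (ProCompletion C)).unit.app
      (fiberEval α F.yoneda a)) := by
  rw [isIso_ranAdjunction_unit_app_iff]
  -- The counit can be the identity, since evaluating `fiberYoneda` at `a` is by definition
  -- evaluation at `a` followed by `y`. The approximation cones are then the cones of the pointwise
  -- Kan condition.
  let e := RightExtension.mk (fiberEval α F.yoneda a)
    (𝟙 (fiberYoneda α F ⋙ fiberEval α F.yoneda a))
  have hl : e.IsPointwiseRightKanExtension := fun G => by
    have l := (h G).nonempty_isLimit.some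
    exact IsLimit.ofIsoLimit (F := StructuredArrow.proj G (fiberYoneda α F) ⋙
        fiberYoneda α F ⋙ fiberEval α F.yoneda a) l
      (Cone.ext (Iso.refl _) fun i =>
        ((Category.id_comp _).trans (Category.comp_id _)).symm)
  exact hl.isRightKanExtension

/-- The extension of a functor that restricts to the inclusion of the fibre over `F` restricts to
the inclusion of the fibre over `yF`. -/
theorem nonempty_extendModel_iso [HasFiniteLimits C] (β : A.Hom B)
    (Q : (restrict C α).Fiber F ⥤ Model C B) (ε : Q ⋙ restrict C β ≅ Fiber.fiberInclusion)
    [∀ G, IsCofiltered (StructuredArrow G (fiberYoneda α F))]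
    (h : ∀ a : A.V, IsIso (((fiberYoneda α F).ranAdjunction (ProCompletion C)).unit.app
      (fiberEval α F.yoneda a))) :
    Nonempty (extendModel (fiberYoneda α F) Q ⋙ restrict (ProCompletion C) β ≅
      Fiber.fiberInclusion) := by
  let L := fiberYoneda α F
  let ev : A.V → (restrict C α).Fiber F ⥤ C := fun a => fiberEval α F a
  let ev' : A.V → (restrict (ProCompletion C) α).Fiber F.yoneda ⥤ ProCompletion C :=
    fun a => fiberEval α F.yoneda a
  let evMap : ∀ {a b : A.V} (_ : a ⟶ b), ev a ⟶ ev b := fun e =>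
    whiskerLeft Fiber.fiberInclusion (modelEvalMap C e)
  let evMap' : ∀ {a b : A.V} (_ : a ⟶ b), ev' a ⟶ ev' b := fun e =>
    whiskerLeft Fiber.fiberInclusion (modelEvalMap (ProCompletion C) e)
  let ε' : ∀ a : A.V, Q ⋙ modelEval C (β.obj a) ≅ ev a := fun a =>
    isoWhiskerRight ε (modelEval C a)
  have hε : ∀ {a b : A.V} (e : a ⟶ b),
      whiskerLeft Q (modelEvalMap C (β.map e)) ≫ (ε' b).hom = (ε' a).hom ≫ evMap e := fun e =>
    NatTrans.ext (funext fun G => (ε.hom.app G).naturality e)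
  let u : ∀ a, ev' a ≅ (proRan L).obj (ev a) := fun a =>
    @asIso _ _ _ _ ((L.ranAdjunction (ProCompletion C)).unit.app (ev' a)) (h a)
  have hu : ∀ {a b : A.V} (e : a ⟶ b),
      evMap' e ≫ (u b).hom = (u a).hom ≫ (proRan L).map (evMap e) := fun e =>
    (L.ranAdjunction (ProCompletion C)).unit.naturality (evMap' e)
  -- The extension of `ε` at `a`, followed by the inverse of the unit.
  let ψ : ∀ a : A.V, (proRan L).obj (Q ⋙ modelEval C (β.obj a)) ≅ ev' a := fun a =>
    (proRan L).mapIso (ε' a) ≪≫ (u a).symm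
  have hψ : ∀ {a b : A.V} (e : a ⟶ b),
      (proRan L).map (whiskerLeft Q (modelEvalMap C (β.map e))) ≫ (ψ b).hom =
        (ψ a).hom ≫ evMap' e := fun {a b} e => by
    have hu' : (u a).inv ≫ evMap' e = (proRan L).map (evMap e) ≫ (u b).inv := by
      rw [Iso.inv_comp_eq, ← Category.assoc, ← hu, Category.assoc, Iso.hom_inv_id,
        Category.comp_id]
    change _ ≫ (proRan L).map (ε' b).hom ≫ (u b).inv =
      ((proRan L).map (ε' a).hom ≫ (u a).inv) ≫ evMap' e
    rw [Category.assoc, hu', ← Category.assoc, ← Functor.map_comp, hε, Functor.map_comp,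
      Category.assoc]
  exact ⟨NatIso.ofComponents
    (fun G => Model.isoMk (fun a => (ψ a).app G)
      (fun e => congrArg (fun t => t.app G) (hψ e)))
    (fun {G G'} m => Model.Hom.ext (funext fun a => (ψ a).hom.naturality m))⟩

/-- The inclusion of a fibre is injective on objects and faithful. -/
theorem fiber_functor_ext {M N E : Type*} [Category* M] [Category* N] [Category* E] {p : M ⥤ N}
    {S : N} {T T' : E ⥤ p.Fiber S} (h : T ⋙ Fiber.fiberInclusion = T' ⋙ Fiber.fiberInclusion) :
    T = T' := by
  refine CategoryTheory.Functor.ext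
    (fun x => Fiber.fiberInclusion_obj_inj (Functor.congr_obj h x)) fun x x' m => ?_
  apply Fiber.fiberInclusion.map_injective
  rw [Functor.map_comp, Functor.map_comp, eqToHom_map, eqToHom_map]
  exact Functor.congr_hom h m

end Verification

end Exactness

/-! ### The verification for `yF` -/

theorem theorem2p2 {X A B : Exactness.Sketch} (α : X.Hom A) (β : A.Hom B)
    (hα : α.IsSubsketchInclusion) (hβ : β.IsSubsketchInclusion)
    (hα_unc : α.IsUnconditionalOfFiniteKind)
    (C : Type u) [SmallCategory C] [HasFiniteLimits C] (F : Exactness.Model C X)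
    (h : Exactness.HasFunctorialVerification α β F) :
    Exactness.HasFunctorialVerification α β F.yoneda := by
  obtain ⟨K, hcomm, hlim, hcolim⟩ := hα_unc
  obtain ⟨E, hE⟩ := h
  have hcof : ∀ G, IsCofiltered (StructuredArrow G (Exactness.fiberYoneda α F)) := fun G =>
    Exactness.isCofiltered_structuredArrow_fiberYoneda K G hcomm hlim hcolim hα.obj_injective
  have hunit := fun a => Exactness.isIso_unit_fiberEval (α := α) (F := F) a fun G =>
    Exactness.isProLimit_fiberApproximation K G hcomm hlim hcolim hα.obj_injective a
  have hE' : (E ⋙ Functor.Fiber.fiberInclusion) ⋙ Exactness.restrict C β =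
      Functor.Fiber.fiberInclusion :=
    congrArg (fun T => T ⋙ Functor.Fiber.fiberInclusion) hE
  obtain ⟨ψ⟩ := Exactness.nonempty_extendModel_iso β (E ⋙ Functor.Fiber.fiberInclusion)
    (eqToIso hE') hunit
  -- The Kan extension restricts to the inclusion only up to `ψ`; replacing it by an isomorphic
  -- functor makes it a strict section, which therefore also lies over `yF` strictly.
  obtain ⟨Q, hQ⟩ := (Exactness.isIsofibration_restrict β hβ.obj_injective).exists_comp_eq ψ
  have hQ' : Q ⋙ Exactness.restrict (Exactness.ProCompletion C) (α.comp β) =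
      (Functor.const _).obj F.yoneda :=
    (congrArg (fun T => T ⋙ Exactness.restrict _ α) hQ).trans
      Functor.Fiber.fiberInclusion_comp_eq_const
  exact ⟨Functor.Fiber.inducedFunctor hQ', Exactness.fiber_functor_ext hQ⟩
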